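/- Let $N>1$ and let $\Omega\subset\mathbb R^N$ be a bounded domain whose boundary is locally a continuous graph: for every $x\in\partial\Omega$ there are orthonormal coordinates $(y',y_N)$ and a continuous function $\gamma$ such that, in a neighbourhood of $x$, $\Omega$ is the set $\{y_N>\gamma(y')\}$ (this includes domains whose boundary is locally the graph of a piecewise $\mathcal C^1$ function). Let $n\ge 1$ be an integer. For an open set $U\subset\mathbb R^N$ and $u\in L^1(U)$ put $$\int_U|\nabla u|=\sup\Big\{\int_U u\,\mathrm{div}\,\varphi \;:\; \varphi\in C^1_c(U;\mathbb R^N),\ |\varphi|\le 1\Big\}\in[0,\infty],$$ and call a set $E$ a Caccioppoli set in $U$ if $\chi_E\in BV(U)$, i.e. $\chi_E\in L^1(U)$ and $\int_U|\nabla\chi_E|<\infty$. Let $$\lambda_{0,n}=\inf\Big\{\int_\Omega|\nabla\chi_E|+n\Big(\int_\Omega\chi_E-1\Big)^2 \;:\; E\subset\subset\Omega,\ E \text{ a Caccioppoli set in }\Omega\Big\},$$ and let $$J_n(E)=\int_\Omega|\nabla\chi_E|+\int_{\partial\Omega}\chi_E+n\Big(\int_\Omega\chi_E-1\Big)^2$$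 be the relaxed functional, where the boundary term $\int_{\partial\Omega}\chi_E$ is the mass on $\partial\Omega$ of the gradient of the extension by zero of $\chi_E|_\Omega$ to $\mathbb R^N$: $$\int_{\partial\Omega}\chi_E=|\nabla\chi_{E\cap\Omega}|(\partial\Omega)=\inf\Big\{\int_U|\nabla\chi_{E\cap\Omega}| \;:\; U \text{ open},\ \partial\Omega\subset U\Big\}.$$ Then $\lambda_{0,n}$ is achieved in the relaxed sense: there is a set $E\subset\Omega$ which is a Caccioppoli set in $\mathbb R^N$ and satisfies $$J_n(E)=\lambda_{0,n}\qquad\text{and}\qquad J_n(E)\le J_n(F)\ \text{ for every Caccioppoli set } F \text{ in } \Omega .$$ -/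

import Mathlib

open MeasureTheory Set Topology
open scoped ENNReal

noncomputable section

/-- The divergence `∑ᵢ ∂ᵢ φᵢ` of a vector field on `ℝ^N`. -/
def divergence {N : ℕ} (φ : EuclideanSpace ℝ (Fin N) → EuclideanSpace ℝ (Fin N))
    (x : EuclideanSpace ℝ (Fin N)) : ℝ :=
  ∑ i : Fin N, (fderiv ℝ φ x (EuclideanSpace.single i (1 : ℝ))) i

/-- The admissible fields in the definition of the total variation on `U`: vector fields of class
`C¹` on `ℝ^N` with compact support contained in `U` and Euclidean length at most `1`. -/
def testFields {N : ℕ} (U : Set (EuclideanSpace ℝ (Fin N))) :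
    Set (EuclideanSpace ℝ (Fin N) → EuclideanSpace ℝ (Fin N)) :=
  {φ | ContDiff ℝ 1 φ ∧ HasCompactSupport φ ∧ tsupport φ ⊆ U ∧ ∀ x, ‖φ x‖ ≤ 1}

/-- The total variation `∫_U |∇u|` of `u` in the open set `U`, for `u` integrable on `U`:
the supremum of `∫_U u div φ` over the admissible fields `φ`, possibly `∞`. -/
def totalVariation {N : ℕ} (u : EuclideanSpace ℝ (Fin N) → ℝ)
    (U : Set (EuclideanSpace ℝ (Fin N))) : ℝ≥0∞ :=
  ⨆ φ ∈ testFields U, ENNReal.ofReal (∫ x in U, u x * divergence φ x)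

/-- `u ∈ BV(U)`, for an open set `U`. -/
def IsBV {N : ℕ} (u : EuclideanSpace ℝ (Fin N) → ℝ)
    (U : Set (EuclideanSpace ℝ (Fin N))) : Prop :=
  IntegrableOn u U volume ∧ totalVariation u U < ∞

/-- The characteristic function of `E`. -/
def charFn {N : ℕ} (E : Set (EuclideanSpace ℝ (Fin N))) :
    EuclideanSpace ℝ (Fin N) → ℝ :=
  E.indicator fun _ => 1

/-- `E` is a Caccioppoli set in the open set `U`: its characteristic function belongs to
`BV(U)`. -/
def IsCaccioppoli {N : ℕ} (E U : Set (EuclideanSpace ℝ (Fin N))) : Prop :=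
  IsBV (charFn E) U

/-- The value `|∇v|(A)` of the variation measure of `v` on an arbitrary set `A`: the infimum of
the total variations of `v` in the open sets that contain `A`. -/
def variationOn {N : ℕ} (v : EuclideanSpace ℝ (Fin N) → ℝ)
    (A : Set (EuclideanSpace ℝ (Fin N))) : ℝ≥0∞ :=
  ⨅ U : {U : Set (EuclideanSpace ℝ (Fin N)) // IsOpen U ∧ A ⊆ U}, totalVariation v U.1

/-- The boundary term `∫_{∂Ω} |u|`, as the mass on `∂Ω` of the gradient of the extension `ũ` of `u`
by zero outside `Ω`. (The gradient of `ũ` is `∇u` in `Ω` and `-u n δ_{∂Ω}` on `∂Ω`, where `n` is the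
outer unit normal, `δ_{∂Ω}` the surface measure, and `u` on `∂Ω` is the trace.) -/
def boundaryTerm {N : ℕ} (u : EuclideanSpace ℝ (Fin N) → ℝ)
    (Ω : Set (EuclideanSpace ℝ (Fin N))) : ℝ≥0∞ :=
  variationOn (Ω.indicator u) (frontier Ω)

/-- The penalization `n (∫_Ω χ_E - 1)²`. -/
def penalty {N : ℕ} (n : ℕ) (Ω E : Set (EuclideanSpace ℝ (Fin N))) : ℝ≥0∞ :=
  ENNReal.ofReal (n * ((∫ x in Ω, charFn E x) - 1) ^ 2)

/-- The functional `∫_Ω |∇χ_E| + n (∫_Ω χ_E - 1)²`. -/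
def energy {N : ℕ} (n : ℕ) (Ω E : Set (EuclideanSpace ℝ (Fin N))) : ℝ≥0∞ :=
  totalVariation (charFn E) Ω + penalty n Ω E

/-- The relaxed functional `∫_Ω |∇χ_E| + ∫_{∂Ω} χ_E + n (∫_Ω χ_E - 1)²`. -/
def relaxedEnergy {N : ℕ} (n : ℕ) (Ω E : Set (EuclideanSpace ℝ (Fin N))) : ℝ≥0∞ :=
  totalVariation (charFn E) Ω + boundaryTerm (charFn E) Ω + penalty n Ω E

/-- `λ_{0,n}`: the infimum of `∫_Ω |∇χ_E| + n (∫_Ω χ_E - 1)²` over the Caccioppoli sets `E` whose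
closure is a compact subset of `Ω`. -/
def lambdaZero {N : ℕ} (n : ℕ) (Ω : Set (EuclideanSpace ℝ (Fin N))) : ℝ≥0∞ :=
  ⨅ E : {E : Set (EuclideanSpace ℝ (Fin N)) //
      IsCaccioppoli E Ω ∧ IsCompact (closure E) ∧ closure E ⊆ Ω}, energy n Ω E.1

/-- The boundary of `Ω` is locally a continuous graph with `Ω` on one side of it: near each boundary
point there are a unit vector `e` and a continuous function `γ` of the coordinates orthogonal to `e`
such that `Ω` is the set of the points whose `e`-coordinate is greater than `γ`. A boundary that is
locally the graph of a piecewise `C¹` function has this property. -/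
def HasGraphBoundary {N : ℕ} (Ω : Set (EuclideanSpace ℝ (Fin N))) : Prop :=
  ∀ x ∈ frontier Ω, ∃ (e : EuclideanSpace ℝ (Fin N)) (γ : EuclideanSpace ℝ (Fin N) → ℝ),
    ‖e‖ = 1 ∧ Continuous γ ∧ (∀ (y : EuclideanSpace ℝ (Fin N)) (t : ℝ), γ (y + t • e) = γ y) ∧
      ∃ U ∈ 𝓝 x, ∀ y ∈ U, (y ∈ Ω ↔ γ y < inner ℝ e y)

end

/-! Extension by zero moves the relaxed functional to the whole space. The variation of χ_{F∩Ω} in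
ℝ^N is its variation in Ω plus its mass on ∂Ω (`totalVariation_univ_eq_add_variationOn`), so J_n(F)
is the perimeter of F∩Ω in ℝ^N plus the penalization (`relaxedEnergy_eq`). For E ⊂⊂ Ω the boundary
mass vanishes and J_n is the energy that defines λ_{0,n}. Two inequalities remain.

Some E ⊆ Ω has J_n(E) ≤ λ_{0,n} by the direct method (`exists_relaxedEnergy_le_lambdaZero`): a
minimizing sequence has bounded perimeter and lives in the compact closure of Ω, so a subsequence
converges in L¹; perimeter is lower semicontinuous and the penalization continuous. The compactness
combines weak L² limits with mollification, whose error is uniform because ‖v(·+h) − v‖₁ ≤ |h| TV(v)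
(`lintegral_translate_sub_le`).

Conversely λ_{0,n} ≤ J_n(F) for every F (`HasGraphBoundary.lambdaZero_le_relaxedEnergy`); only here
does the shape of ∂Ω matter. The set F∩Ω is approximated, in measure and perimeter, by sets
compactly inside Ω. A partition of unity cuts χ_{F∩Ω} into pieces, each pushed into Ω along its own
graph direction; the gradients of the partition cancel, so the variation grows by a quantity that
tends to 0 (`totalVariation_sum_translate_le`). Mollification followed by a good superlevel set,
found by a coarea average (`exists_totalVariation_superlevel_le`), turns the function back into a
set. -/

/-! ### Divergence of vector fields and integration by parts. -/

section DivergenceCalculus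

open Filter

variable {N : ℕ}

theorem divergence_eq_sum_fderiv_apply {φ : EuclideanSpace ℝ (Fin N) → EuclideanSpace ℝ (Fin N)}
    {x : EuclideanSpace ℝ (Fin N)} (hφ : DifferentiableAt ℝ φ x) :
    divergence φ x =
      ∑ i : Fin N, fderiv ℝ (fun y => φ y i) x (EuclideanSpace.single i (1 : ℝ)) := by
  refine Finset.sum_congr rfl fun i _ => ?_
  have h := ((EuclideanSpace.proj (𝕜 := ℝ) i).hasFDerivAt.comp x hφ.hasFDerivAt).fderiv
  have h' : (⇑(EuclideanSpace.proj (𝕜 := ℝ) i) ∘ φ) = fun y => φ y i := by ext y; simp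
  rw [h'] at h
  rw [h]
  simp

theorem sum_smul_single_eq (v : EuclideanSpace ℝ (Fin N)) :
    ∑ i : Fin N, v i • EuclideanSpace.single i (1 : ℝ) = v := by
  ext j
  simp [Pi.single_apply]

theorem divergence_smul {ζ : EuclideanSpace ℝ (Fin N) → ℝ}
    {φ : EuclideanSpace ℝ (Fin N) → EuclideanSpace ℝ (Fin N)} {x : EuclideanSpace ℝ (Fin N)}
    (hζ : DifferentiableAt ℝ ζ x) (hφ : DifferentiableAt ℝ φ x) :
    divergence (fun y => ζ y • φ y) x = ζ x * divergence φ x + fderiv ℝ ζ x (φ x) := by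
  unfold divergence
  have h : fderiv ℝ (fun y => ζ y • φ y) x = _ := fderiv_fun_smul hζ hφ
  rw [h]
  conv_rhs => rw [← sum_smul_single_eq (φ x), map_sum, Finset.mul_sum, ← Finset.sum_add_distrib]
  refine Finset.sum_congr rfl fun i _ => ?_
  simp [mul_comm]

theorem divergence_add {φ ψ : EuclideanSpace ℝ (Fin N) → EuclideanSpace ℝ (Fin N)}
    {x : EuclideanSpace ℝ (Fin N)} (hφ : DifferentiableAt ℝ φ x) (hψ : DifferentiableAt ℝ ψ x) :
    divergence (fun y => φ y + ψ y) x = divergence φ x + divergence ψ x := by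
  unfold divergence
  rw [fderiv_fun_add hφ hψ, ← Finset.sum_add_distrib]
  simp

theorem divergence_sum {ι : Type*} (s : Finset ι)
    {φ : ι → EuclideanSpace ℝ (Fin N) → EuclideanSpace ℝ (Fin N)} {x : EuclideanSpace ℝ (Fin N)}
    (hφ : ∀ i ∈ s, DifferentiableAt ℝ (φ i) x) :
    divergence (fun y => ∑ i ∈ s, φ i y) x = ∑ i ∈ s, divergence (φ i) x := by
  unfold divergence
  rw [fderiv_fun_sum hφ, Finset.sum_comm]
  simp [Finset.sum_apply]

theorem divergence_comp_add_right (φ : EuclideanSpace ℝ (Fin N) → EuclideanSpace ℝ (Fin N))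
    (h x : EuclideanSpace ℝ (Fin N)) :
    divergence (fun y => φ (y + h)) x = divergence φ (x + h) := by
  unfold divergence
  rw [fderiv_comp_add_right]

theorem continuous_divergence {φ : EuclideanSpace ℝ (Fin N) → EuclideanSpace ℝ (Fin N)}
    (hφ : ContDiff ℝ 1 φ) : Continuous (divergence φ) := by
  unfold divergence
  have := hφ.continuous_fderiv one_ne_zero
  fun_prop

theorem divergence_eq_zero_of_notMem_tsupport
    {φ : EuclideanSpace ℝ (Fin N) → EuclideanSpace ℝ (Fin N)} {x : EuclideanSpace ℝ (Fin N)}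
    (hx : x ∉ tsupport φ) : divergence φ x = 0 := by
  have : fderiv ℝ φ x = 0 := by
    by_contra h
    exact hx (support_fderiv_subset ℝ h)
  simp [divergence, this]

theorem hasCompactSupport_divergence {φ : EuclideanSpace ℝ (Fin N) → EuclideanSpace ℝ (Fin N)}
    (hφ : HasCompactSupport φ) : HasCompactSupport (divergence φ) :=
  hφ.mono' fun x hx => by
    by_contra h
    exact hx (divergence_eq_zero_of_notMem_tsupport h)

theorem integrable_mul_divergence {φ : EuclideanSpace ℝ (Fin N) → EuclideanSpace ℝ (Fin N)}
    (hφ : ContDiff ℝ 1 φ) (hc : HasCompactSupport φ) {u : EuclideanSpace ℝ (Fin N) → ℝ}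
    (hu : LocallyIntegrable u) : Integrable fun x => u x * divergence φ x := by
  have := hu.integrable_smul_right_of_hasCompactSupport (continuous_divergence hφ)
    (hasCompactSupport_divergence hc)
  simpa [mul_comm] using this

/-- Integration by parts against a compactly supported field. -/
theorem integral_mul_divergence {w : EuclideanSpace ℝ (Fin N) → ℝ}
    {φ : EuclideanSpace ℝ (Fin N) → EuclideanSpace ℝ (Fin N)} (hw : ContDiff ℝ 1 w)
    (hφ : ContDiff ℝ 1 φ) (hc : HasCompactSupport φ) :
    ∫ x, w x * divergence φ x = -∫ x, fderiv ℝ w x (φ x) := by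
  have hφi : ∀ i, ContDiff ℝ 1 fun y => φ y i := fun i => by fun_prop
  have hci : ∀ i, HasCompactSupport fun y => φ y i := fun i =>
    hc.comp_left (g := fun v : EuclideanSpace ℝ (Fin N) => v i) (by simp)
  have hw' := hw.continuous_fderiv one_ne_zero
  have hint1 : ∀ i, Integrable fun x => fderiv ℝ w x (EuclideanSpace.single i (1 : ℝ)) * φ x i :=
    fun i => (Continuous.mul (by fun_prop) (hφi i).continuous).integrable_of_hasCompactSupport
      ((hci i).mul_left)
  have hint2 : ∀ i, Integrable fun x => w x *
      fderiv ℝ (fun y => φ y i) x (EuclideanSpace.single i (1 : ℝ)) := fun i => by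
    have h1 := (hφi i).continuous_fderiv one_ne_zero
    refine (Continuous.mul hw.continuous (by fun_prop)).integrable_of_hasCompactSupport
      (HasCompactSupport.mul_left ?_)
    exact (hci i).fderiv_apply ℝ _
  have h1 : ∀ x, w x * divergence φ x = ∑ i : Fin N,
      w x * fderiv ℝ (fun y => φ y i) x (EuclideanSpace.single i (1 : ℝ)) := fun x => by
    rw [divergence_eq_sum_fderiv_apply (hφ.differentiable one_ne_zero x), Finset.mul_sum]
  have h2 : ∀ x, fderiv ℝ w x (φ x) = ∑ i : Fin N,
      fderiv ℝ w x (EuclideanSpace.single i (1 : ℝ)) * φ x i := fun x => by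
    conv_lhs => rw [← sum_smul_single_eq (φ x), map_sum]
    simp [mul_comm]
  simp_rw [h1, h2]
  rw [integral_finsetSum _ fun i _ => hint2 i, integral_finsetSum _ fun i _ => hint1 i,
    ← Finset.sum_neg_distrib]
  refine Finset.sum_congr rfl fun i _ => ?_
  exact integral_mul_fderiv_eq_neg_fderiv_mul_of_integrable (hint1 i) (hint2 i)
    ((hw.continuous.mul (hφi i).continuous).integrable_of_hasCompactSupport (hci i).mul_left)
    (fun x _ => hw.differentiable one_ne_zero x)
    (fun x _ => (hφi i).differentiable one_ne_zero x)

end DivergenceCalculus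

/-! ### Total variation: lower semicontinuity, and its value ∫|∇w| on smooth functions. -/

section TotalVariation

open Filter

variable {N : ℕ}

theorem setIntegral_mul_divergence {U : Set (EuclideanSpace ℝ (Fin N))}
    {φ : EuclideanSpace ℝ (Fin N) → EuclideanSpace ℝ (Fin N)} (hφ : tsupport φ ⊆ U)
    (u : EuclideanSpace ℝ (Fin N) → ℝ) :
    ∫ x in U, u x * divergence φ x = ∫ x, u x * divergence φ x :=
  setIntegral_eq_integral_of_forall_compl_eq_zero fun x hx => by
    rw [divergence_eq_zero_of_notMem_tsupport fun h => hx (hφ h), mul_zero]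

theorem ofReal_integral_le_totalVariation {U : Set (EuclideanSpace ℝ (Fin N))}
    {φ : EuclideanSpace ℝ (Fin N) → EuclideanSpace ℝ (Fin N)} (hφ : φ ∈ testFields U)
    (u : EuclideanSpace ℝ (Fin N) → ℝ) :
    ENNReal.ofReal (∫ x, u x * divergence φ x) ≤ totalVariation u U := by
  rw [← setIntegral_mul_divergence hφ.2.2.1]
  exact le_iSup₂ (f := fun φ (_ : φ ∈ testFields U) =>
    ENNReal.ofReal (∫ x in U, u x * divergence φ x)) φ hφ

theorem totalVariation_le {U : Set (EuclideanSpace ℝ (Fin N))}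
    {u : EuclideanSpace ℝ (Fin N) → ℝ} {C : ℝ≥0∞}
    (h : ∀ φ ∈ testFields U, ENNReal.ofReal (∫ x, u x * divergence φ x) ≤ C) :
    totalVariation u U ≤ C :=
  iSup₂_le fun φ hφ => by
    rw [setIntegral_mul_divergence hφ.2.2.1]
    exact h φ hφ

theorem testFields_mono {U V : Set (EuclideanSpace ℝ (Fin N))} (h : U ⊆ V) :
    testFields U ⊆ testFields V :=
  fun _ hφ => ⟨hφ.1, hφ.2.1, hφ.2.2.1.trans h, hφ.2.2.2⟩

theorem totalVariation_mono {U V : Set (EuclideanSpace ℝ (Fin N))} (h : U ⊆ V)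
    (u : EuclideanSpace ℝ (Fin N) → ℝ) : totalVariation u U ≤ totalVariation u V :=
  totalVariation_le fun _ hφ => ofReal_integral_le_totalVariation (testFields_mono h hφ) u

theorem totalVariation_congr {U : Set (EuclideanSpace ℝ (Fin N))}
    {u v : EuclideanSpace ℝ (Fin N) → ℝ} (h : ∀ᵐ x, x ∈ U → u x = v x) :
    totalVariation u U = totalVariation v U := by
  have key : ∀ φ ∈ testFields U,
      ∫ x, u x * divergence φ x = ∫ x, v x * divergence φ x := fun φ hφ => by
    refine integral_congr_ae (h.mono fun x hx => ?_)
    by_cases hxU : x ∈ U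
    · simp only [hx hxU]
    · simp [divergence_eq_zero_of_notMem_tsupport fun h => hxU (hφ.2.2.1 h)]
  refine le_antisymm (totalVariation_le fun φ hφ => ?_) (totalVariation_le fun φ hφ => ?_)
  · rw [key φ hφ]
    exact ofReal_integral_le_totalVariation hφ v
  · rw [← key φ hφ]
    exact ofReal_integral_le_totalVariation hφ u

/-- Lower semicontinuity of the total variation under convergence against test fields. -/
theorem totalVariation_le_liminf {U : Set (EuclideanSpace ℝ (Fin N))}
    {u : EuclideanSpace ℝ (Fin N) → ℝ} {f : ℕ → EuclideanSpace ℝ (Fin N) → ℝ}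
    (h : ∀ φ ∈ testFields U, Tendsto (fun k => ∫ x, f k x * divergence φ x) atTop
      (𝓝 (∫ x, u x * divergence φ x))) :
    totalVariation u U ≤ liminf (fun k => totalVariation (f k) U) atTop := by
  refine totalVariation_le fun φ hφ => ?_
  rw [← ((ENNReal.continuous_ofReal.tendsto _).comp (h φ hφ)).liminf_eq]
  exact liminf_le_liminf (Eventually.of_forall fun k => ofReal_integral_le_totalVariation hφ (f k))

theorem exists_norm_divergence_le {φ : EuclideanSpace ℝ (Fin N) → EuclideanSpace ℝ (Fin N)}
    (hφ : ContDiff ℝ 1 φ) (hc : HasCompactSupport φ) : ∃ C : ℝ, ∀ x, ‖divergence φ x‖ ≤ C := by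
  obtain ⟨C, hC⟩ := (hasCompactSupport_divergence hc).exists_bound_of_continuous
    (continuous_divergence hφ)
  exact ⟨C, hC⟩

/-- Convergence in `L¹` implies convergence against test fields. -/
theorem tendsto_integral_mul_divergence {u : EuclideanSpace ℝ (Fin N) → ℝ}
    {f : ℕ → EuclideanSpace ℝ (Fin N) → ℝ} (hu : Integrable u) (hf : ∀ k, Integrable (f k))
    (hfu : Tendsto (fun k => ∫⁻ x, ‖f k x - u x‖ₑ) atTop (𝓝 0))
    {φ : EuclideanSpace ℝ (Fin N) → EuclideanSpace ℝ (Fin N)}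
    (hφ : ContDiff ℝ 1 φ) (hc : HasCompactSupport φ) :
    Tendsto (fun k => ∫ x, f k x * divergence φ x) atTop (𝓝 (∫ x, u x * divergence φ x)) := by
  obtain ⟨C, hC⟩ := exists_norm_divergence_le hφ hc
  refine tendsto_integral_of_L1 _ (integrable_mul_divergence hφ hc hu.locallyIntegrable).aestronglyMeasurable
    (Eventually.of_forall fun k => integrable_mul_divergence hφ hc (hf k).locallyIntegrable) ?_
  have h0 : Tendsto (fun k => (∫⁻ x, ‖f k x - u x‖ₑ) * ENNReal.ofReal C) atTop (𝓝 0) := by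
    simpa using ENNReal.Tendsto.mul_const hfu (Or.inr ENNReal.ofReal_ne_top)
  refine tendsto_of_tendsto_of_tendsto_of_le_of_le tendsto_const_nhds h0 (fun _ => zero_le)
    fun k => ?_
  simp only
  rw [← lintegral_mul_const' _ _ ENNReal.ofReal_ne_top]
  refine lintegral_mono fun x => ?_
  simp only
  rw [← sub_mul, enorm_mul]
  gcongr
  rw [← ofReal_norm]
  exact ENNReal.ofReal_le_ofReal (hC x)

theorem totalVariation_le_liminf_of_tendsto {U : Set (EuclideanSpace ℝ (Fin N))}
    {u : EuclideanSpace ℝ (Fin N) → ℝ} {f : ℕ → EuclideanSpace ℝ (Fin N) → ℝ}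
    (hu : Integrable u) (hf : ∀ k, Integrable (f k))
    (hfu : Tendsto (fun k => ∫⁻ x, ‖f k x - u x‖ₑ) atTop (𝓝 0)) :
    totalVariation u U ≤ liminf (fun k => totalVariation (f k) U) atTop :=
  totalVariation_le_liminf fun _ hφ => tendsto_integral_mul_divergence hu hf hfu hφ.1 hφ.2.1

theorem ofReal_integral_le_lintegral_enorm {α : Type*} [MeasurableSpace α] {μ : Measure α}
    (f : α → ℝ) : ENNReal.ofReal (∫ x, f x ∂μ) ≤ ∫⁻ x, ‖f x‖ₑ ∂μ := by
  refine le_trans ?_ (enorm_integral_le_lintegral_enorm f)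
  rw [← ofReal_norm]
  exact ENNReal.ofReal_le_ofReal (le_abs_self _)

theorem totalVariation_le_lintegral_fderiv {w : EuclideanSpace ℝ (Fin N) → ℝ}
    (hw : ContDiff ℝ 1 w) (U : Set (EuclideanSpace ℝ (Fin N))) :
    totalVariation w U ≤ ∫⁻ x, ‖fderiv ℝ w x‖ₑ := by
  refine totalVariation_le fun φ hφ => ?_
  rw [integral_mul_divergence hw hφ.1 hφ.2.1, ← integral_neg]
  refine (ofReal_integral_le_lintegral_enorm _).trans (lintegral_mono fun x => ?_)
  simp only [enorm_neg]
  rw [← ofReal_norm, ← ofReal_norm]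
  refine ENNReal.ofReal_le_ofReal (((fderiv ℝ w x).le_opNorm _).trans ?_)
  exact mul_le_of_le_one_right (norm_nonneg _) (hφ.2.2.2 x)

theorem contDiff_sqrt_norm_sq_add {E F : Type*} [NormedAddCommGroup E] [NormedSpace ℝ E]
    [NormedAddCommGroup F] [InnerProductSpace ℝ F] {g : E → F} (hg : ContDiff ℝ 1 g) {c : ℝ}
    (hc : 0 < c) : ContDiff ℝ 1 fun x => Real.sqrt (‖g x‖ ^ 2 + c) := by
  have h : ContDiff ℝ 1 fun x => ‖g x‖ ^ 2 + c := (hg.norm_sq ℝ).add contDiff_const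
  exact h.sqrt fun x => (by positivity)

theorem neg_inv_smul_mem_testFields {G : EuclideanSpace ℝ (Fin N) → EuclideanSpace ℝ (Fin N)}
    {S : EuclideanSpace ℝ (Fin N) → ℝ} (hG : ContDiff ℝ 1 G) (hc : HasCompactSupport G)
    (hS : ContDiff ℝ 1 S) (hpos : ∀ x, 0 < S x) (hle : ∀ x, ‖G x‖ ≤ S x) :
    (fun x => (-(S x)⁻¹) • G x) ∈ testFields univ := by
  have h1 : ContDiff ℝ 1 fun x => -(S x)⁻¹ := (hS.inv fun x => (hpos x).ne').neg
  refine ⟨h1.smul hG, hc.smul_left (f := fun x => -(S x)⁻¹), subset_univ _, fun x => ?_⟩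
  rw [norm_smul, norm_neg, norm_inv, Real.norm_eq_abs, abs_of_pos (hpos x),
    inv_mul_le_iff₀ (hpos x), mul_one]
  exact hle x

/-- The ideal test field -∇w/|∇w| is singular where ∇w = 0. Replacing |∇w| by √(|∇w|² + (k+1)⁻²)
gives an admissible field, of class C¹ because w is C², and Fatou's lemma recovers ∫|∇w| as k → ∞.
-/
theorem lintegral_fderiv_le_totalVariation {w : EuclideanSpace ℝ (Fin N) → ℝ}
    (hw : ContDiff ℝ 2 w) (hc : HasCompactSupport w) :
    ∫⁻ x, ‖fderiv ℝ w x‖ₑ ≤ totalVariation w univ := by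
  have hwd : ContDiff ℝ 1 (fun x => gradient w x) :=
    (InnerProductSpace.toDual ℝ (EuclideanSpace ℝ (Fin N))).symm.contDiff.comp
      (hw.fderiv_right (m := 1) (by norm_num))
  have hgn : ∀ x, ‖gradient w x‖ = ‖fderiv ℝ w x‖ := fun x => by simp [gradient]
  have hgs : HasCompactSupport fun x => gradient w x :=
    (hc.fderiv ℝ).comp_left (g := (InnerProductSpace.toDual ℝ _).symm) (by simp)
  have hfi : ∀ x (v : EuclideanSpace ℝ (Fin N)), fderiv ℝ w x v = inner ℝ (gradient w x) v :=
    fun x v => by simp [gradient]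
  have hpos : ∀ (k : ℕ) x, 0 < ‖gradient w x‖ ^ 2 + (1 / (k + 1 : ℝ)) ^ 2 := fun k x => by
    positivity
  let S : ℕ → EuclideanSpace ℝ (Fin N) → ℝ :=
    fun k x => Real.sqrt (‖gradient w x‖ ^ 2 + (1 / (k + 1 : ℝ)) ^ 2)
  have hSpos : ∀ k x, 0 < S k x := fun k x => Real.sqrt_pos.2 (hpos k x)
  have hSle : ∀ k x, ‖gradient w x‖ ≤ S k x := fun k x =>
    Real.le_sqrt_of_sq_le (by have : 0 ≤ (1 / (k + 1 : ℝ)) ^ 2 := by positivity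
                              linarith)
  have hSle' : ∀ k x, S k x ≤ ‖gradient w x‖ + 1 / (k + 1 : ℝ) := fun k x => by
    refine Real.sqrt_le_iff.2 ⟨by positivity, ?_⟩
    have : 0 ≤ ‖gradient w x‖ * (1 / (k + 1 : ℝ)) := by positivity
    nlinarith
  have hSd : ∀ k, ContDiff ℝ 1 (S k) := fun k =>
    contDiff_sqrt_norm_sq_add hwd (by positivity)
  let φ : ℕ → EuclideanSpace ℝ (Fin N) → EuclideanSpace ℝ (Fin N) :=
    fun k x => (-(S k x)⁻¹) • gradient w x
  have hφ : ∀ k, φ k ∈ testFields (univ : Set (EuclideanSpace ℝ (Fin N))) := fun k =>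
    neg_inv_smul_mem_testFields hwd hgs (hSd k) (hSpos k) (hSle k)
  have hval : ∀ k, ∫ x, w x * divergence (φ k) x = ∫ x, (S k x)⁻¹ * ‖gradient w x‖ ^ 2 :=
    fun k => by
      rw [integral_mul_divergence (hw.of_le (by norm_num)) (hφ k).1 (hφ k).2.1, ← integral_neg]
      refine integral_congr_ae (Eventually.of_forall fun x => ?_)
      simp only [φ, hfi, inner_smul_right, real_inner_self_eq_norm_sq]
      ring
  have hnn : ∀ k x, 0 ≤ (S k x)⁻¹ * ‖gradient w x‖ ^ 2 := fun k x =>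
    mul_nonneg (inv_nonneg.2 (hSpos k x).le) (by positivity)
  have hcont : ∀ k, Continuous fun x => (S k x)⁻¹ * ‖gradient w x‖ ^ 2 := fun k =>
    ((hSd k).continuous.inv₀ fun x => (hSpos k x).ne').mul (hwd.continuous.norm.pow 2)
  have hle : ∀ k, ∫⁻ x, ENNReal.ofReal ((S k x)⁻¹ * ‖gradient w x‖ ^ 2) ≤
      totalVariation w univ := fun k => by
    rw [← ofReal_integral_eq_lintegral_ofReal _ (Eventually.of_forall (hnn k)), ← hval k]
    · exact ofReal_integral_le_totalVariation (hφ k) w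
    · refine (hcont k).integrable_of_hasCompactSupport (HasCompactSupport.mul_left ?_)
      exact hgs.comp_left (g := fun v => ‖v‖ ^ 2) (by simp)
  have hlim : ∀ x, Tendsto (fun k => ENNReal.ofReal ((S k x)⁻¹ * ‖gradient w x‖ ^ 2)) atTop
      (𝓝 ‖fderiv ℝ w x‖ₑ) := fun x => by
    rw [← ofReal_norm, ← hgn]
    refine (ENNReal.continuous_ofReal.tendsto _).comp ?_
    -- At a critical point (S k x)⁻¹ blows up, but the factor ‖∇w‖² is already zero.
    rcases eq_or_ne (‖gradient w x‖) 0 with h0 | h0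
    · simp [h0]
    have hSt : Tendsto (fun k => S k x) atTop (𝓝 ‖gradient w x‖) :=
      tendsto_of_tendsto_of_tendsto_of_le_of_le tendsto_const_nhds
        (by simpa using tendsto_const_nhds.add (tendsto_one_div_add_atTop_nhds_zero_nat (𝕜 := ℝ)))
        (fun k => hSle k x) (fun k => hSle' k x)
    have := (hSt.inv₀ h0).mul_const (‖gradient w x‖ ^ 2)
    convert this using 2
    field_simp
  calc ∫⁻ x, ‖fderiv ℝ w x‖ₑ
      = ∫⁻ x, liminf (fun k => ENNReal.ofReal ((S k x)⁻¹ * ‖gradient w x‖ ^ 2)) atTop :=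
        lintegral_congr fun x => (hlim x).liminf_eq.symm
    _ ≤ liminf (fun k => ∫⁻ x, ENNReal.ofReal ((S k x)⁻¹ * ‖gradient w x‖ ^ 2)) atTop :=
        lintegral_liminf_le fun k => (hcont k).measurable.ennreal_ofReal
    _ ≤ liminf (fun _ : ℕ => totalVariation w univ) atTop :=
        liminf_le_liminf (Eventually.of_forall hle)
    _ = totalVariation w univ := liminf_const _

end TotalVariation

/-! ### Finite smooth partitions of unity. -/

section PartitionOfUnity

theorem exists_smooth_partition {E : Type*} [NormedAddCommGroup E] [NormedSpace ℝ E]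
    [FiniteDimensional ℝ E] {ι : Type*} [Fintype ι] {K : Set E} (hK : IsClosed K) (U : ι → Set E)
    (hU : ∀ i, IsOpen (U i)) (hKU : K ⊆ ⋃ i, U i) :
    ∃ ζ : ι → E → ℝ, (∀ i, ContDiff ℝ 2 (ζ i)) ∧ (∀ i, tsupport (ζ i) ⊆ U i) ∧
      (∀ i x, 0 ≤ ζ i x) ∧ (∀ x, ∑ i, ζ i x ≤ 1) ∧ ∀ x ∈ K, ∑ i, ζ i x = 1 := by
  obtain ⟨f, hf⟩ := SmoothPartitionOfUnity.exists_isSubordinate (modelWithCornersSelf ℝ E)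
    hK U hU hKU
  refine ⟨fun i => f i, fun i => ?_, hf, fun i x => f.nonneg i x, fun x => ?_, fun x hx => ?_⟩
  · exact ((f i).contMDiff.contDiff).of_le (by norm_cast)
  · rw [← finsum_eq_sum_of_fintype]
    exact f.sum_le_one x
  · rw [← finsum_eq_sum_of_fintype]
    exact f.sum_eq_one hx

end PartitionOfUnity

/-! ### Additivity of the variation over open sets, and its splitting along ∂Ω. -/

section Additivity

open Filter

variable {N : ℕ}

theorem hasCompactSupport_smul_field (ζ : EuclideanSpace ℝ (Fin N) → ℝ)
    {φ : EuclideanSpace ℝ (Fin N) → EuclideanSpace ℝ (Fin N)} (hφ : HasCompactSupport φ) :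
    HasCompactSupport fun x => ζ x • φ x :=
  hφ.smul_left (f := ζ)

theorem tsupport_smul_field_subset (ζ : EuclideanSpace ℝ (Fin N) → ℝ)
    (φ : EuclideanSpace ℝ (Fin N) → EuclideanSpace ℝ (Fin N)) :
    tsupport (fun x => ζ x • φ x) ⊆ tsupport ζ :=
  tsupport_smul_subset_left ζ φ

/-- The unit ball is convex and contains 0, so subconvex combinations keep the length bound. The
fields may differ from one index to another, which is what translating the pieces separately
requires. -/
theorem sum_smul_mem_testFields {ι : Type*} [Fintype ι] {ζ : ι → EuclideanSpace ℝ (Fin N) → ℝ}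
    {φ : ι → EuclideanSpace ℝ (Fin N) → EuclideanSpace ℝ (Fin N)}
    (hζ : ∀ i, ContDiff ℝ 1 (ζ i)) (h0 : ∀ i x, 0 ≤ ζ i x) (h1 : ∀ x, ∑ i, ζ i x ≤ 1)
    (hφ : ∀ i, φ i ∈ testFields univ) :
    (fun x => ∑ i, ζ i x • φ i x) ∈ testFields univ := by
  refine ⟨ContDiff.sum fun i _ => (hζ i).smul (hφ i).1, ?_, subset_univ _, fun x => ?_⟩
  · have := HasCompactSupport.finset_sum (s := Finset.univ) (f := fun i x => ζ i x • φ i x)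
      fun i _ => hasCompactSupport_smul_field (ζ i) (hφ i).2.1
    rwa [Finset.sum_fn] at this
  · refine (norm_sum_le _ _).trans ((Finset.sum_le_sum fun i _ => ?_).trans (h1 x))
    rw [norm_smul, Real.norm_of_nonneg (h0 i x)]
    exact mul_le_of_le_one_right (h0 i x) ((hφ i).2.2.2 x)

/-- A partition of unity on the support of φ splits φ into fields that are admissible in the
individual U i. -/
theorem totalVariation_iUnion_le {ι : Type*} [Fintype ι] {v : EuclideanSpace ℝ (Fin N) → ℝ}
    (hv : LocallyIntegrable v) (U : ι → Set (EuclideanSpace ℝ (Fin N))) (hU : ∀ i, IsOpen (U i)) :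
    totalVariation v (⋃ i, U i) ≤ ∑ i, totalVariation v (U i) := by
  refine totalVariation_le fun φ hφ => ?_
  obtain ⟨ζ, hζ, hζU, h0, h1, hK⟩ := exists_smooth_partition (isClosed_tsupport φ) U hU hφ.2.2.1
  have hζ1 : ∀ i, ContDiff ℝ 1 (ζ i) := fun i => (hζ i).of_le (by norm_num)
  have hmem : ∀ i, (fun x => ζ i x • φ x) ∈ testFields (U i) := fun i => by
    refine ⟨(hζ1 i).smul hφ.1, hasCompactSupport_smul_field (ζ i) hφ.2.1,
      (tsupport_smul_field_subset (ζ i) φ).trans (hζU i),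
      fun x => ?_⟩
    rw [norm_smul, Real.norm_of_nonneg (h0 i x)]
    exact mul_le_one₀ ((Finset.single_le_sum (fun j _ => h0 j x) (Finset.mem_univ i)).trans (h1 x))
      (norm_nonneg _) (hφ.2.2.2 x)
  have hsum : (fun x => ∑ i, ζ i x • φ x) = φ := by
    ext1 x
    rw [← Finset.sum_smul]
    by_cases hx : x ∈ tsupport φ
    · rw [hK x hx, one_smul]
    · rw [image_eq_zero_of_notMem_tsupport hx, smul_zero]
  have hint : ∫ x, v x * divergence φ x =
      ∑ i, ∫ x, v x * divergence (fun y => ζ i y • φ y) x := by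
    rw [← integral_finsetSum _ fun i _ => integrable_mul_divergence (hmem i).1 (hmem i).2.1 hv]
    refine integral_congr_ae (Eventually.of_forall fun x => ?_)
    simp only
    rw [← Finset.mul_sum, ← divergence_sum _ fun i _ => (hmem i).1.differentiable one_ne_zero x,
      hsum]
  rw [hint]
  exact (Finset.le_sum_of_subadditive _ ENNReal.ofReal_zero.le (fun _ _ => ENNReal.ofReal_add_le) _ _).trans
    (Finset.sum_le_sum fun i _ => ofReal_integral_le_totalVariation (hmem i) v)

theorem zero_mem_testFields (U : Set (EuclideanSpace ℝ (Fin N))) :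
    (fun _ => 0) ∈ testFields U :=
  ⟨contDiff_const, HasCompactSupport.zero, by simp [tsupport], by simp⟩

/-- Two admissible fields with disjoint supports have an admissible sum, since at each point at most
one of them is nonzero. -/
theorem ofReal_integral_add_totalVariation_compl_le {v : EuclideanSpace ℝ (Fin N) → ℝ}
    (hv : LocallyIntegrable v) {φ : EuclideanSpace ℝ (Fin N) → EuclideanSpace ℝ (Fin N)}
    (hφ : φ ∈ testFields univ) :
    ENNReal.ofReal (∫ x, v x * divergence φ x) + totalVariation v (tsupport φ)ᶜ ≤
      totalVariation v univ := by
  -- `ENNReal.ofReal` truncates negative values, so it is additive only once both integrals are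
  -- known to be nonnegative.
  rcases le_total (∫ x, v x * divergence φ x) 0 with hle | hpos
  · rw [ENNReal.ofReal_of_nonpos hle, zero_add]
    exact totalVariation_mono (subset_univ _) v
  rw [← ENNReal.le_sub_iff_add_le_left ENNReal.ofReal_ne_top (ofReal_integral_le_totalVariation hφ v)]
  refine totalVariation_le fun ψ hψ => ?_
  rw [ENNReal.le_sub_iff_add_le_left ENNReal.ofReal_ne_top (ofReal_integral_le_totalVariation hφ v)]
  rcases le_total (∫ x, v x * divergence ψ x) 0 with hle' | hpos'
  · rw [ENNReal.ofReal_of_nonpos hle', add_zero]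
    exact ofReal_integral_le_totalVariation hφ v
  rw [← ENNReal.ofReal_add hpos hpos',
    ← integral_add (integrable_mul_divergence hφ.1 hφ.2.1 hv)
      (integrable_mul_divergence hψ.1 hψ.2.1 hv)]
  have hmem : (fun x => φ x + ψ x) ∈ testFields univ := by
    refine ⟨hφ.1.add hψ.1, hφ.2.1.add hψ.2.1, subset_univ _, fun x => ?_⟩
    by_cases hx : x ∈ tsupport φ
    · have : ψ x = 0 := image_eq_zero_of_notMem_tsupport fun h => hψ.2.2.1 h hx
      simpa [this] using hφ.2.2.2 x
    · simpa [image_eq_zero_of_notMem_tsupport hx] using hψ.2.2.2 x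
  have heq : ∀ x, v x * divergence φ x + v x * divergence ψ x =
      v x * divergence (fun y => φ y + ψ y) x := fun x => by
    rw [divergence_add (hφ.1.differentiable one_ne_zero x) (hψ.1.differentiable one_ne_zero x),
      mul_add]
  simp_rw [heq]
  exact ofReal_integral_le_totalVariation hmem v

/-- The variation of a function that vanishes outside an open set `Ω` splits into the variation
in `Ω` and the mass on the boundary. -/
theorem totalVariation_univ_eq_add_variationOn {v : EuclideanSpace ℝ (Fin N) → ℝ}
    {Ω : Set (EuclideanSpace ℝ (Fin N))} (hv : LocallyIntegrable v) (hΩ : IsOpen Ω)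
    (h0 : ∀ x ∉ Ω, v x = 0) :
    totalVariation v univ = totalVariation v Ω + variationOn v (frontier Ω) := by
  apply le_antisymm
  · unfold variationOn
    rw [ENNReal.add_iInf]
    refine le_iInf fun U => ?_
    -- The domain, a neighbourhood of its boundary and the exterior cover ℝ^N; the exterior
    -- contributes nothing because v vanishes there.
    let W : Fin 3 → Set (EuclideanSpace ℝ (Fin N)) := ![Ω, U.1, (closure Ω)ᶜ]
    have hW : ∀ i, IsOpen (W i) := fun i => by
      fin_cases i
      · exact hΩ
      · exact U.2.1
      · exact isClosed_closure.isOpen_compl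
    have hcov : (⋃ i, W i) = univ := by
      refine eq_univ_of_forall fun x => mem_iUnion.2 ?_
      by_cases hx : x ∈ closure Ω
      · by_cases hx' : x ∈ Ω
        · exact ⟨0, hx'⟩
        · exact ⟨1, U.2.2 ⟨hx, by rwa [hΩ.interior_eq]⟩⟩
      · exact ⟨2, hx⟩
    have hext : totalVariation v (closure Ω)ᶜ = 0 := by
      refine le_antisymm (totalVariation_le fun φ hφ => ?_) zero_le
      have : ∀ x, v x * divergence φ x = 0 := fun x => by
        by_cases hx : x ∈ Ω
        · rw [divergence_eq_zero_of_notMem_tsupport fun h => hφ.2.2.1 h (subset_closure hx),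
            mul_zero]
        · rw [h0 x hx, zero_mul]
      simp [this]
    have := totalVariation_iUnion_le hv W hW
    rw [hcov, Fin.sum_univ_three] at this
    refine this.trans_eq ?_
    change totalVariation v Ω + totalVariation v U.1 + totalVariation v (closure Ω)ᶜ = _
    rw [hext, add_zero]
  · have hφ : ∀ φ ∈ testFields Ω, ENNReal.ofReal (∫ x in Ω, v x * divergence φ x) +
        variationOn v (frontier Ω) ≤ totalVariation v univ := fun φ hφ => by
      rw [setIntegral_mul_divergence hφ.2.2.1]
      refine le_trans ?_ (ofReal_integral_add_totalVariation_compl_le hv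
        (testFields_mono (subset_univ _) hφ))
      gcongr
      -- For φ supported in Ω, the complement of its support is an open neighbourhood of ∂Ω, hence a
      -- competitor in the infimum.
      refine iInf_le (fun U : {U : Set (EuclideanSpace ℝ (Fin N)) //
        IsOpen U ∧ frontier Ω ⊆ U} => totalVariation v U.1)
        ⟨(tsupport φ)ᶜ, (isClosed_tsupport φ).isOpen_compl, fun x hx hx' => ?_⟩
      exact hx.2 (by rw [hΩ.interior_eq]; exact hφ.2.2.1 hx')
    unfold totalVariation
    rw [ENNReal.biSup_add' ⟨_, zero_mem_testFields Ω⟩]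
    exact iSup₂_le hφ

end Additivity

/-! ### Continuity of translations in L¹. -/

section Translation

open Filter

theorem tendsto_lintegral_enorm_sub_translate {E F : Type*} [NormedAddCommGroup E]
    [NormedSpace ℝ E] [FiniteDimensional ℝ E] [MeasurableSpace E] [BorelSpace E]
    {μ : Measure E} [μ.IsAddHaarMeasure] [NormedAddCommGroup F] {f : E → F} (hf : Integrable f μ) :
    Tendsto (fun h => ∫⁻ x, ‖f (x + h) - f x‖ₑ ∂μ) (𝓝 0) (𝓝 0) := by
  have : Fact ((1 : ℝ≥0∞) ≤ 1) := ⟨le_rfl⟩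
  let g : E → C(E, E) := fun h => ⟨fun x => x + h, by fun_prop⟩
  -- Continuity for the compact-open topology, which the joint continuity of addition gives by
  -- currying.
  have hg : Continuous g := by
    let G : C(E × E, E) := ⟨fun p => p.2 + p.1, by fun_prop⟩
    exact (ContinuousMap.curry G).continuous
  have hgm : ∀ h, MeasurePreserving (g h) μ μ := fun h => measurePreserving_add_right μ h
  have hfm : MemLp f 1 μ := memLp_one_iff_integrable.2 hf
  have hcont := (continuous_const (y := hfm.toLp f)).compMeasurePreservingLp hg hgm
    ENNReal.one_ne_top
  have h0 := (hcont.tendsto 0)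
  rw [Lp.tendsto_Lp_iff_tendsto_eLpNorm'] at h0
  refine h0.congr fun h => ?_
  rw [eLpNorm_one_eq_lintegral_enorm]
  refine lintegral_congr_ae ?_
  have e1 := Lp.coeFn_compMeasurePreserving (hfm.toLp f) (hgm h)
  have e2 := Lp.coeFn_compMeasurePreserving (hfm.toLp f) (hgm 0)
  have e3 := (hgm h).quasiMeasurePreserving.ae_eq_comp hfm.coeFn_toLp
  have e4 := (hgm 0).quasiMeasurePreserving.ae_eq_comp hfm.coeFn_toLp
  filter_upwards [e1, e2, e3, e4] with x h1 h2 h3 h4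
  simp only [Pi.sub_apply]
  rw [h1, h2, h3, h4]
  simp [g]

end Translation

/-! ### Mollification: L¹ error, variation and support. -/

section Mollification

open Filter ContinuousLinearMap

variable {N : ℕ}

theorem convolution_normed_apply (ρ : ContDiffBump (0 : EuclideanSpace ℝ (Fin N)))
    (v : EuclideanSpace ℝ (Fin N) → ℝ) (x : EuclideanSpace ℝ (Fin N)) :
    convolution (ρ.normed volume) v (lsmul ℝ ℝ) volume x =
      ∫ t, ρ.normed volume t * v (x - t) := by
  simp [convolution]

theorem lintegral_normed_bump (ρ : ContDiffBump (0 : EuclideanSpace ℝ (Fin N))) :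
    ∫⁻ t, ENNReal.ofReal (ρ.normed volume t) = 1 := by
  rw [← ofReal_integral_eq_lintegral_ofReal ρ.integrable_normed
    (Eventually.of_forall ρ.nonneg_normed), ρ.integral_normed, ENNReal.ofReal_one]

/-- The `L¹` distance of a function from its mollification is controlled by translations. -/
theorem lintegral_convolution_sub_le (ρ : ContDiffBump (0 : EuclideanSpace ℝ (Fin N)))
    {v : EuclideanSpace ℝ (Fin N) → ℝ} (hv : Integrable v) {C : ℝ≥0∞}
    (hC : ∀ t, ‖t‖ < ρ.rOut → ∫⁻ x, ‖v (x + t) - v x‖ₑ ≤ C) :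
    ∫⁻ x, ‖convolution (ρ.normed volume) v (lsmul ℝ ℝ) volume x - v x‖ₑ ≤ C := by
  have hρc : Continuous (ρ.normed volume) := ρ.continuous_normed
  have hi1 : Integrable (fun p : EuclideanSpace ℝ (Fin N) × EuclideanSpace ℝ (Fin N) =>
      ρ.normed volume p.2 * v (p.1 - p.2)) (volume.prod volume) := by
    simpa using (ρ.integrable_normed (μ := volume)).convolution_integrand (lsmul ℝ ℝ) hv
  have hi2 : Integrable (fun p : EuclideanSpace ℝ (Fin N) × EuclideanSpace ℝ (Fin N) =>
      v p.1 * ρ.normed volume p.2) (volume.prod volume) := hv.mul_prod ρ.integrable_normed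
  have hm : AEMeasurable (fun p : EuclideanSpace ℝ (Fin N) × EuclideanSpace ℝ (Fin N) =>
      ‖ρ.normed volume p.2 * v (p.1 - p.2) - v p.1 * ρ.normed volume p.2‖ₑ)
      (volume.prod volume) := (hi1.sub hi2).aestronglyMeasurable.enorm
  have key : ∀ᵐ x, ‖convolution (ρ.normed volume) v (lsmul ℝ ℝ) volume x - v x‖ₑ ≤
      ∫⁻ t, ‖ρ.normed volume t * v (x - t) - v x * ρ.normed volume t‖ₑ := by
    filter_upwards [hi1.prod_right_ae] with x hx
    have h1 : v x = ∫ t, v x * ρ.normed volume t := by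
      rw [integral_const_mul, ρ.integral_normed, mul_one]
    rw [convolution_normed_apply]
    conv_lhs => rw [h1]
    rw [← integral_sub hx (ρ.integrable_normed.const_mul _)]
    exact enorm_integral_le_lintegral_enorm _
  calc ∫⁻ x, ‖convolution (ρ.normed volume) v (lsmul ℝ ℝ) volume x - v x‖ₑ
      ≤ ∫⁻ x, ∫⁻ t, ‖ρ.normed volume t * v (x - t) - v x * ρ.normed volume t‖ₑ :=
        lintegral_mono_ae key
    _ = ∫⁻ t, ∫⁻ x, ‖ρ.normed volume t * v (x - t) - v x * ρ.normed volume t‖ₑ :=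
        lintegral_lintegral_swap hm
    _ = ∫⁻ t, ENNReal.ofReal (ρ.normed volume t) * ∫⁻ x, ‖v (x - t) - v x‖ₑ := by
        refine lintegral_congr fun t => ?_
        rw [← lintegral_const_mul' _ _ ENNReal.ofReal_ne_top]
        refine lintegral_congr fun x => ?_
        rw [mul_comm (v x), ← mul_sub, enorm_mul, Real.enorm_of_nonneg (ρ.nonneg_normed t)]
    _ ≤ ∫⁻ t, ENNReal.ofReal (ρ.normed volume t) * C := by
        refine lintegral_mono fun t => ?_
        simp only
        rcases lt_or_ge ‖t‖ ρ.rOut with ht | ht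
        · gcongr
          simpa [sub_eq_add_neg] using hC (-t) (by simpa using ht)
        · have : t ∉ Function.support (ρ.normed volume) := by
            rw [ρ.support_normed_eq]
            simpa using ht
          rw [Function.notMem_support.1 this]
          simp
    _ = C := by
        rw [lintegral_mul_const _ hρc.measurable.ennreal_ofReal, lintegral_normed_bump, one_mul]

theorem comp_add_right_mem_testFields
    {φ : EuclideanSpace ℝ (Fin N) → EuclideanSpace ℝ (Fin N)} (hφ : φ ∈ testFields univ)
    (h : EuclideanSpace ℝ (Fin N)) : (fun x => φ (x + h)) ∈ testFields univ :=
  ⟨hφ.1.comp (contDiff_id.add contDiff_const), hφ.2.1.comp_homeomorph (Homeomorph.addRight h),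
    subset_univ _, fun x => hφ.2.2.2 (x + h)⟩

/-- By Fubini, pairing ρ ∗ v with div φ averages, with weight ρ, the pairings of v with the
translates of φ; each translate is admissible. -/
theorem totalVariation_convolution_le (ρ : ContDiffBump (0 : EuclideanSpace ℝ (Fin N)))
    {v : EuclideanSpace ℝ (Fin N) → ℝ} (hv : Integrable v) :
    totalVariation (convolution (ρ.normed volume) v (lsmul ℝ ℝ) volume) univ ≤
      totalVariation v univ := by
  by_cases htop : totalVariation v univ = ∞
  · rw [htop]; exact le_top
  refine totalVariation_le fun φ hφ => ?_
  obtain ⟨C, hC⟩ := exists_norm_divergence_le hφ.1 hφ.2.1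
  have hdc := continuous_divergence hφ.1
  have hi1 : Integrable (fun p : EuclideanSpace ℝ (Fin N) × EuclideanSpace ℝ (Fin N) =>
      ρ.normed volume p.2 * v (p.1 - p.2)) (volume.prod volume) := by
    simpa using (ρ.integrable_normed (μ := volume)).convolution_integrand (lsmul ℝ ℝ) hv
  have hi2 : Integrable (fun p : EuclideanSpace ℝ (Fin N) × EuclideanSpace ℝ (Fin N) =>
      ρ.normed volume p.2 * v (p.1 - p.2) * divergence φ p.1) (volume.prod volume) :=
    hi1.mul_bdd (hdc.comp continuous_fst).aestronglyMeasurable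
      (Eventually.of_forall fun p => hC p.1)
  have hinner : ∀ t, ∫ x, ρ.normed volume t * v (x - t) * divergence φ x =
      ρ.normed volume t * ∫ x, v x * divergence (fun y => φ (y + t)) x := fun t => by
    simp only [mul_assoc, integral_const_mul, divergence_comp_add_right]
    rw [← integral_add_right_eq_self (fun x => v (x - t) * divergence φ x) t]
    simp
  have hval : ∫ x, convolution (ρ.normed volume) v (lsmul ℝ ℝ) volume x * divergence φ x =
      ∫ t, ρ.normed volume t * ∫ x, v x * divergence (fun y => φ (y + t)) x := by
    simp_rw [convolution_normed_apply, ← integral_mul_const]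
    rw [integral_integral_swap hi2]
    simp_rw [hinner]
  have hle : ∀ t, ∫ x, v x * divergence (fun y => φ (y + t)) x ≤
      (totalVariation v univ).toReal := fun t =>
    (ENNReal.ofReal_le_iff_le_toReal htop).1
      (ofReal_integral_le_totalVariation (comp_add_right_mem_testFields hφ t) v)
  rw [hval, ENNReal.ofReal_le_iff_le_toReal htop]
  calc ∫ t, ρ.normed volume t * ∫ x, v x * divergence (fun y => φ (y + t)) x
      ≤ ∫ t, ρ.normed volume t * (totalVariation v univ).toReal := by
        refine integral_mono ?_ (ρ.integrable_normed.mul_const _) fun t =>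
          mul_le_mul_of_nonneg_left (hle t) (ρ.nonneg_normed t)
        have := hi2.integral_prod_right
        simp only [hinner] at this
        exact this
    _ = (totalVariation v univ).toReal := by
        rw [integral_mul_const, ρ.integral_normed, one_mul]

theorem contDiff_convolution_normed (ρ : ContDiffBump (0 : EuclideanSpace ℝ (Fin N)))
    {v : EuclideanSpace ℝ (Fin N) → ℝ} (hv : Integrable v) :
    ContDiff ℝ 2 (convolution (ρ.normed volume) v (lsmul ℝ ℝ) volume) :=
  ρ.hasCompactSupport_normed.contDiff_convolution_left (n := 2) (lsmul ℝ ℝ) ρ.contDiff_normed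
    hv.locallyIntegrable

theorem tsupport_convolution_normed_subset (ρ : ContDiffBump (0 : EuclideanSpace ℝ (Fin N)))
    {v : EuclideanSpace ℝ (Fin N) → ℝ} {K : Set (EuclideanSpace ℝ (Fin N))}
    (hK : Function.support v ⊆ K) :
    tsupport (convolution (ρ.normed volume) v (lsmul ℝ ℝ) volume) ⊆
      Metric.cthickening ρ.rOut K := by
  refine closure_minimal ?_ Metric.isClosed_cthickening
  refine (support_convolution_subset_swap _).trans ?_
  rintro _ ⟨x, hx, t, ht, rfl⟩
  rw [ρ.support_normed_eq] at ht
  refine Metric.mem_cthickening_of_dist_le _ x _ _ (hK hx) ?_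
  simpa using (mem_ball_zero_iff.1 ht).le

theorem exists_bump_rOut_eq {r : ℝ} (hr : 0 < r) :
    ∃ ρ : ContDiffBump (0 : EuclideanSpace ℝ (Fin N)), ρ.rOut = r :=
  ⟨⟨r / 2, r, by positivity, by linarith⟩, rfl⟩

/-- Smooth approximation in `L¹` that does not increase the total variation. -/
theorem exists_smooth_approx {v : EuclideanSpace ℝ (Fin N) → ℝ} (hv : Integrable v)
    {K : Set (EuclideanSpace ℝ (Fin N))} (hK : IsCompact K) (hvK : Function.support v ⊆ K)
    {r : ℝ} (hr : 0 < r) {η : ℝ≥0∞} (hη : 0 < η) :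
    ∃ w : EuclideanSpace ℝ (Fin N) → ℝ, ContDiff ℝ 2 w ∧ HasCompactSupport w ∧
      tsupport w ⊆ Metric.cthickening r K ∧ ∫⁻ x, ‖w x - v x‖ₑ ≤ η ∧
      totalVariation w univ ≤ totalVariation v univ := by
  have hev := (tendsto_lintegral_enorm_sub_translate hv).eventually_le_const hη
  obtain ⟨δ, hδ, hδη⟩ := Metric.eventually_nhds_iff.1 hev
  obtain ⟨ρ, hρ⟩ := exists_bump_rOut_eq (N := N) (lt_min hr hδ)
  have hsub := (tsupport_convolution_normed_subset ρ hvK).trans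
    (Metric.cthickening_mono (hρ.le.trans (min_le_left r δ)) K)
  refine ⟨_, contDiff_convolution_normed ρ hv, ?_, hsub,
    lintegral_convolution_sub_le ρ hv fun t ht => hδη ?_, totalVariation_convolution_le ρ hv⟩
  · exact hK.cthickening.of_isClosed_subset (isClosed_tsupport _) hsub
  · rw [dist_zero_right]
    exact ht.trans_le (hρ.le.trans (min_le_right r δ))

end Mollification

/-! ### An averaged coarea inequality for superlevel sets. -/

section Coarea

open Filter

variable {N : ℕ}

/-- A smooth approximation of the Heaviside function at level `s`. -/
noncomputable def heavisideApprox (k : ℕ) (s r : ℝ) : ℝ := Real.smoothTransition (k * (r - s))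

theorem tendsto_heavisideApprox (s r : ℝ) :
    Tendsto (fun k => heavisideApprox k s r) atTop (𝓝 (if s < r then 1 else 0)) := by
  unfold heavisideApprox
  split_ifs with h
  · refine tendsto_const_nhds.congr' ?_
    obtain ⟨n, hn⟩ := exists_nat_ge (1 / (r - s))
    filter_upwards [eventually_ge_atTop n] with k hk
    rw [Real.smoothTransition.one_of_one_le]
    have h1 : 0 < r - s := sub_pos.2 h
    have h2 : (1 / (r - s)) ≤ (k : ℝ) := hn.trans (by exact_mod_cast hk)
    rwa [div_le_iff₀ h1] at h2
  · refine tendsto_const_nhds.congr fun k => ?_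
    rw [Real.smoothTransition.zero_of_nonpos]
    exact mul_nonpos_of_nonneg_of_nonpos (Nat.cast_nonneg k) (by linarith [not_lt.1 h])

theorem differentiable_smoothTransition : Differentiable ℝ Real.smoothTransition :=
  (Real.smoothTransition.contDiff (n := 1)).differentiable one_ne_zero

theorem continuous_deriv_smoothTransition : Continuous (deriv Real.smoothTransition) :=
  (Real.smoothTransition.contDiff (n := 1)).continuous_deriv le_rfl

theorem deriv_smoothTransition_nonneg (x : ℝ) : 0 ≤ deriv Real.smoothTransition x :=
  Real.smoothTransition.monotone.deriv_nonneg

/-- The integrand is the s-derivative of a function with values in [-1, 0]. After Tonelli this bound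
does the work of the coarea formula. -/
theorem lintegral_deriv_heavisideApprox_le (k : ℕ) {a b : ℝ} (hab : a ≤ b) (r : ℝ) :
    ∫⁻ s in Ioo a b, ENNReal.ofReal (k * deriv Real.smoothTransition (k * (r - s))) ≤ 1 := by
  have hder : ∀ s ∈ uIcc a b, HasDerivAt (fun s => -Real.smoothTransition (k * (r - s)))
      (k * deriv Real.smoothTransition (k * (r - s))) s := fun s _ => by
    have h1 : HasDerivAt (fun s : ℝ => (k : ℝ) * (r - s)) (k * (-1)) s :=
      ((hasDerivAt_id s).const_sub r).const_mul (k : ℝ)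
    have h2 := ((differentiable_smoothTransition (k * (r - s))).hasDerivAt.comp s h1).neg
    exact h2.congr_deriv (by ring)
  have hcont : Continuous fun s : ℝ => k * deriv Real.smoothTransition (k * (r - s)) :=
    continuous_const.mul (continuous_deriv_smoothTransition.comp (by fun_prop))
  rw [setLIntegral_congr Ioo_ae_eq_Ioc, ← ofReal_integral_eq_lintegral_ofReal
    ((hcont.intervalIntegrable a b).1) (Eventually.of_forall fun s =>
      mul_nonneg (Nat.cast_nonneg k) (deriv_smoothTransition_nonneg _)),
    ← intervalIntegral.integral_of_le hab,
    intervalIntegral.integral_eq_sub_of_hasDerivAt hder (hcont.intervalIntegrable a b)]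
  rw [ENNReal.ofReal_le_one]
  have h1 := Real.smoothTransition.le_one (k * (r - a))
  have h2 := Real.smoothTransition.nonneg (k * (r - b))
  linarith

theorem enorm_fderiv_heavisideApprox {w : EuclideanSpace ℝ (Fin N) → ℝ} (hw : ContDiff ℝ 1 w)
    (k : ℕ) (s : ℝ) (x : EuclideanSpace ℝ (Fin N)) :
    ‖fderiv ℝ (fun y => heavisideApprox k s (w y)) x‖ₑ =
      ENNReal.ofReal (k * deriv Real.smoothTransition (k * (w x - s))) * ‖fderiv ℝ w x‖ₑ := by
  have h1 : HasDerivAt (fun r : ℝ => (k : ℝ) * (r - s)) (k * 1) (w x) :=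
    ((hasDerivAt_id (w x)).sub_const s).const_mul (k : ℝ)
  have h2 := (differentiable_smoothTransition (k * (w x - s))).hasDerivAt.comp (w x) h1
  have h3 := h2.comp_hasFDerivAt x (hw.differentiable one_ne_zero x).hasFDerivAt
  have h4 : fderiv ℝ (fun y => heavisideApprox k s (w y)) x = _ := h3.fderiv
  rw [h4, enorm_smul, mul_one, mul_comm _ (k : ℝ), Real.enorm_of_nonneg]
  exact mul_nonneg (Nat.cast_nonneg k) (deriv_smoothTransition_nonneg _)

theorem contDiff_heavisideApprox {w : EuclideanSpace ℝ (Fin N) → ℝ} (hw : ContDiff ℝ 1 w)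
    (k : ℕ) (s : ℝ) : ContDiff ℝ 1 fun y => heavisideApprox k s (w y) :=
  (Real.smoothTransition.contDiff (n := 1)).comp
    (contDiff_const.mul (hw.sub contDiff_const))

/-- The smoothed Heaviside functions of w converge pointwise and boundedly to χ_{w>s}; lower
semicontinuity passes to the limit, and the chain rule computes the right-hand side. -/
theorem totalVariation_superlevel_le_liminf {w : EuclideanSpace ℝ (Fin N) → ℝ}
    (hw : ContDiff ℝ 1 w) (s : ℝ) (U : Set (EuclideanSpace ℝ (Fin N))) :
    totalVariation (charFn {x | s < w x}) U ≤
      liminf (fun k : ℕ => ∫⁻ x, ENNReal.ofReal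
        (k * deriv Real.smoothTransition (k * (w x - s))) * ‖fderiv ℝ w x‖ₑ) atTop := by
  refine (totalVariation_le_liminf (f := fun k y => heavisideApprox k s (w y))
    fun φ hφ => ?_).trans (liminf_le_liminf (Eventually.of_forall fun k => ?_))
  · refine tendsto_integral_of_dominated_convergence (fun x => ‖divergence φ x‖)
      (fun k => ?_) ?_ (fun k => Eventually.of_forall fun x => ?_)
      (Eventually.of_forall fun x => ?_)
    · exact ((contDiff_heavisideApprox hw k s).continuous.mul
        (continuous_divergence hφ.1)).aestronglyMeasurable
    · exact ((continuous_divergence hφ.1).integrable_of_hasCompactSupport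
        (hasCompactSupport_divergence hφ.2.1)).norm
    · rw [norm_mul]
      refine mul_le_of_le_one_left (norm_nonneg _) ?_
      rw [heavisideApprox, Real.norm_of_nonneg (Real.smoothTransition.nonneg _)]
      exact Real.smoothTransition.le_one _
    · refine Tendsto.mul_const _ ?_
      convert tendsto_heavisideApprox s (w x) using 2
      simp [charFn, indicator_apply]
  · refine (totalVariation_le_lintegral_fderiv (contDiff_heavisideApprox hw k s) U).trans_eq ?_
    exact lintegral_congr fun x => enorm_fderiv_heavisideApprox hw k s x

/-- A consequence of the coarea formula: some superlevel set at a level between `a` and `b` has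
perimeter at most the average `(b - a)⁻¹ ∫ |∇w|`. -/
theorem exists_totalVariation_superlevel_le {w : EuclideanSpace ℝ (Fin N) → ℝ}
    (hw : ContDiff ℝ 1 w) {a b : ℝ} (hab : a < b) :
    ∃ s ∈ Ioo a b, totalVariation (charFn {x | s < w x}) univ ≤
      (∫⁻ x, ‖fderiv ℝ w x‖ₑ) / ENNReal.ofReal (b - a) := by
  have hfc : Continuous fun x => fderiv ℝ w x := hw.continuous_fderiv one_ne_zero
  let I : ℕ → ℝ → ℝ≥0∞ := fun k s => ∫⁻ x, ENNReal.ofReal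
    (k * deriv Real.smoothTransition (k * (w x - s))) * ‖fderiv ℝ w x‖ₑ
  have hjoint : ∀ k : ℕ, Measurable fun p : ℝ × EuclideanSpace ℝ (Fin N) => ENNReal.ofReal
      (k * deriv Real.smoothTransition (k * (w p.2 - p.1))) * ‖fderiv ℝ w p.2‖ₑ := fun k => by
    have h1 : Continuous fun p : ℝ × EuclideanSpace ℝ (Fin N) =>
        k * deriv Real.smoothTransition (k * (w p.2 - p.1)) :=
      continuous_const.mul (continuous_deriv_smoothTransition.comp
        (continuous_const.mul ((hw.continuous.comp continuous_snd).sub continuous_fst)))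
    exact h1.measurable.ennreal_ofReal.mul (hfc.comp continuous_snd).measurable.enorm
  have hI : ∀ k, Measurable (I k) := fun k => (hjoint k).lintegral_prod_right'
  have hIle : ∀ k, ∫⁻ s in Ioo a b, I k s ≤ ∫⁻ x, ‖fderiv ℝ w x‖ₑ := fun k => by
    rw [lintegral_lintegral_swap (hjoint k).aemeasurable]
    refine lintegral_mono fun x => ?_
    simp only
    rw [lintegral_mul_const' _ _ (by simp)]
    exact mul_le_of_le_one_left zero_le (lintegral_deriv_heavisideApprox_le k hab.le (w x))
  have hlim : ∫⁻ s in Ioo a b, liminf (fun k => I k s) atTop ≤ ∫⁻ x, ‖fderiv ℝ w x‖ₑ := by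
    refine (lintegral_liminf_le hI).trans ?_
    refine (liminf_le_liminf (Eventually.of_forall hIle)).trans_eq ?_
    exact liminf_const _
  have hvol : volume (Ioo a b) = ENNReal.ofReal (b - a) := Real.volume_Ioo
  have hne : volume (Ioo a b) ≠ 0 := by
    rw [hvol]
    simpa using hab
  -- Some level does no worse than the average of the liminf over (a, b), which Fatou and Tonelli
  -- have bounded.
  obtain ⟨s, hs, hle⟩ := exists_le_setLAverage hne (by rw [hvol]; exact ENNReal.ofReal_ne_top)
    (Measurable.liminf hI).aemeasurable
  refine ⟨s, hs, (totalVariation_superlevel_le_liminf hw s univ).trans (hle.trans ?_)⟩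
  rw [setLAverage_eq, hvol]
  exact ENNReal.div_le_div_right hlim _

end Coarea

/-! ### The bound ‖v(·+h) − v‖₁ ≤ |h| TV(v). -/

section TranslationEstimate

open Filter

variable {N : ℕ}

theorem lintegral_enorm_sub_le {α : Type*} [MeasurableSpace α] {μ : Measure α} {f g : α → ℝ}
    (h : α → ℝ) (hf : AEStronglyMeasurable f μ) (hg : AEStronglyMeasurable g μ) :
    ∫⁻ x, ‖f x - h x‖ₑ ∂μ ≤ (∫⁻ x, ‖f x - g x‖ₑ ∂μ) + ∫⁻ x, ‖g x - h x‖ₑ ∂μ := by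
  rw [← lintegral_add_left' (f := fun x => ‖f x - g x‖ₑ) (hf.sub hg).enorm]
  refine lintegral_mono fun x => ?_
  simpa using enorm_add_le (f x - g x) (g x - h x)

/-- The fundamental theorem of calculus along the segment from x to x + h, then Tonelli and
translation invariance. -/
theorem lintegral_translate_sub_le_of_contDiff {w : EuclideanSpace ℝ (Fin N) → ℝ}
    (hw : ContDiff ℝ 1 w) (h : EuclideanSpace ℝ (Fin N)) :
    ∫⁻ x, ‖w (x + h) - w x‖ₑ ≤ ‖h‖ₑ * ∫⁻ x, ‖fderiv ℝ w x‖ₑ := by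
  have hfc : Continuous fun x => fderiv ℝ w x := hw.continuous_fderiv one_ne_zero
  have key : ∀ x, ‖w (x + h) - w x‖ₑ ≤
      ∫⁻ t in Ioc (0 : ℝ) 1, ‖h‖ₑ * ‖fderiv ℝ w (x + t • h)‖ₑ := fun x => by
    have hder : ∀ t ∈ uIcc (0 : ℝ) 1, HasDerivAt (fun t : ℝ => w (x + t • h))
        (fderiv ℝ w (x + t • h) h) t := fun t _ => by
      have h1 : HasDerivAt (fun t : ℝ => x + t • h) ((1 : ℝ) • h) t :=
        ((hasDerivAt_id t).smul_const h).const_add x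
      have h2 := (hw.differentiable one_ne_zero (x + t • h)).hasFDerivAt.comp_hasDerivAt t h1
      exact h2.congr_deriv (by simp)
    have hcont : Continuous fun t : ℝ => fderiv ℝ w (x + t • h) h := by fun_prop
    have hFTC := intervalIntegral.integral_eq_sub_of_hasDerivAt hder
      (hcont.intervalIntegrable 0 1)
    simp only [one_smul, zero_smul, add_zero] at hFTC
    rw [← hFTC, intervalIntegral.integral_of_le zero_le_one]
    refine (enorm_integral_le_lintegral_enorm _).trans (lintegral_mono fun t => ?_)
    rw [mul_comm]
    exact ContinuousLinearMap.le_opENorm _ _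
  have hjm : Measurable fun p : EuclideanSpace ℝ (Fin N) × ℝ =>
      ‖h‖ₑ * ‖fderiv ℝ w (p.1 + p.2 • h)‖ₑ := by
    have : Continuous fun p : EuclideanSpace ℝ (Fin N) × ℝ => fderiv ℝ w (p.1 + p.2 • h) :=
      hfc.comp (by fun_prop)
    exact this.measurable.enorm.const_mul _
  calc ∫⁻ x, ‖w (x + h) - w x‖ₑ
      ≤ ∫⁻ x, ∫⁻ t in Ioc (0 : ℝ) 1, ‖h‖ₑ * ‖fderiv ℝ w (x + t • h)‖ₑ := lintegral_mono key
    _ = ∫⁻ t in Ioc (0 : ℝ) 1, ∫⁻ x, ‖h‖ₑ * ‖fderiv ℝ w (x + t • h)‖ₑ :=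
        lintegral_lintegral_swap hjm.aemeasurable
    _ = ∫⁻ _ in Ioc (0 : ℝ) 1, ‖h‖ₑ * ∫⁻ x, ‖fderiv ℝ w x‖ₑ := by
        refine lintegral_congr fun t => ?_
        rw [lintegral_const_mul' _ _ enorm_ne_top,
          lintegral_add_right_eq_self (fun x => ‖fderiv ℝ w x‖ₑ)]
    _ = ‖h‖ₑ * ∫⁻ x, ‖fderiv ℝ w x‖ₑ := by simp

/-- The `L¹` modulus of continuity of a `BV` function. -/
theorem lintegral_translate_sub_le {v : EuclideanSpace ℝ (Fin N) → ℝ} (hv : Integrable v)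
    {K : Set (EuclideanSpace ℝ (Fin N))} (hK : IsCompact K) (hvK : Function.support v ⊆ K)
    (h : EuclideanSpace ℝ (Fin N)) :
    ∫⁻ x, ‖v (x + h) - v x‖ₑ ≤ ‖h‖ₑ * totalVariation v univ := by
  refine ENNReal.le_of_forall_pos_le_add fun ε hε _ => ?_
  -- The error ε/2 is paid twice, at x + h and at x; the thickening radius 1 is arbitrary.
  obtain ⟨w, hw, hwc, -, hwv, hTV⟩ := exists_smooth_approx hv hK hvK one_pos
    (η := (ε / 2 : NNReal)) (by exact_mod_cast half_pos hε)
  have hw1 : ContDiff ℝ 1 w := hw.of_le (by norm_num)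
  have hvh : AEStronglyMeasurable (fun x => v (x + h)) volume :=
    (hv.comp_add_right h).aestronglyMeasurable
  have hwh : AEStronglyMeasurable (fun x => w (x + h)) volume :=
    (hw.continuous.comp (by fun_prop)).aestronglyMeasurable
  have e1 : ∫⁻ x, ‖v (x + h) - w (x + h)‖ₑ ≤ (ε / 2 : NNReal) := by
    rw [lintegral_add_right_eq_self (fun x => ‖v x - w x‖ₑ) h]
    refine le_trans (lintegral_mono fun x => ?_) hwv
    simp only
    rw [enorm_sub_rev]
  have e2 := (lintegral_translate_sub_le_of_contDiff hw1 h).trans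
    (mul_le_mul_right ((lintegral_fderiv_le_totalVariation hw hwc).trans hTV) ‖h‖ₑ)
  calc ∫⁻ x, ‖v (x + h) - v x‖ₑ
      ≤ (∫⁻ x, ‖v (x + h) - w (x + h)‖ₑ) +
          ((∫⁻ x, ‖w (x + h) - w x‖ₑ) + ∫⁻ x, ‖w x - v x‖ₑ) :=
        (lintegral_enorm_sub_le v hvh hwh).trans (add_le_add le_rfl
          (lintegral_enorm_sub_le v hwh hw.continuous.aestronglyMeasurable))
    _ ≤ (ε / 2 : NNReal) + (‖h‖ₑ * totalVariation v univ + (ε / 2 : NNReal)) := by gcongr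
    _ = ‖h‖ₑ * totalVariation v univ + ε := by
        rw [add_left_comm, ← ENNReal.coe_add, add_halves]

end TranslationEstimate

/-! ### Compactness in L¹ under a bound on the variation. -/

section Compactness

open Filter ContinuousLinearMap

variable {N : ℕ}

/-- Domination by g bounds the sequence in the separable Hilbert space L². Sequential
Banach–Alaoglu, applied to the functionals ⟪v k, ·⟫, gives one subsequence that serves all ψ. -/
theorem exists_subseq_tendsto_integral_mul {α : Type*} [MeasurableSpace α] {μ : Measure α}
    [IsSeparable μ] {v : ℕ → α → ℝ} {g : α → ℝ} (hm : ∀ k, AEStronglyMeasurable (v k) μ)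
    (hg : MemLp g 2 μ) (hvg : ∀ k x, ‖v k x‖ ≤ ‖g x‖) :
    ∃ ns : ℕ → ℕ, StrictMono ns ∧ ∀ ψ : α → ℝ, MemLp ψ 2 μ →
      ∃ L : ℝ, Tendsto (fun k => ∫ x, ψ x * v (ns k) x ∂μ) atTop (𝓝 L) := by
  have : Fact ((1 : ℝ≥0∞) ≤ 2) := ⟨by norm_num⟩
  have : Fact ((2 : ℝ≥0∞) ≠ ∞) := ⟨by norm_num⟩
  have hv2 : ∀ k, MemLp (v k) 2 μ := fun k => hg.mono (hm k) (Eventually.of_forall (hvg k))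
  let V : ℕ → Lp ℝ 2 μ := fun k => (hv2 k).toLp (v k)
  have hV : ∀ k, ‖V k‖ ≤ (eLpNorm g 2 μ).toReal := fun k => by
    rw [Lp.norm_toLp]
    exact ENNReal.toReal_mono hg.2.ne (eLpNorm_mono (hvg k))
  let φ : ℕ → WeakDual ℝ (Lp ℝ 2 μ) := fun k =>
    StrongDual.toWeakDual (innerSL ℝ (V k) : Lp ℝ 2 μ →L[ℝ] ℝ)
  have hφ : ∀ k, φ k ∈ WeakDual.toStrongDual ⁻¹'
      Metric.closedBall (0 : StrongDual ℝ (Lp ℝ 2 μ)) (eLpNorm g 2 μ).toReal := fun k => by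
    rw [mem_preimage, mem_closedBall_zero_iff]
    refine le_trans (le_of_eq ?_) (hV k)
    exact innerSL_apply_norm ℝ (V k)
  obtain ⟨φ₀, -, ns, hns, hlim⟩ := WeakDual.isSeqCompact_closedBall ℝ (Lp ℝ 2 μ) _ _ hφ
  refine ⟨ns, hns, fun ψ hψ => ⟨φ₀ (hψ.toLp ψ), ?_⟩⟩
  have h1 := ((WeakDual.eval_continuous (hψ.toLp ψ)).tendsto φ₀).comp hlim
  refine h1.congr fun k => ?_
  change inner ℝ (V (ns k)) (hψ.toLp ψ) = _
  rw [L2.inner_def]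
  refine integral_congr_ae ?_
  filter_upwards [(hv2 (ns k)).coeFn_toLp, hψ.coeFn_toLp] with x h1 h2
  simp only [V]
  rw [h1, h2]
  simp

theorem norm_convolution_normed_le (ρ : ContDiffBump (0 : EuclideanSpace ℝ (Fin N)))
    {v : EuclideanSpace ℝ (Fin N) → ℝ} (hv : ∀ x, ‖v x‖ ≤ 1) (x : EuclideanSpace ℝ (Fin N)) :
    ‖convolution (ρ.normed volume) v (lsmul ℝ ℝ) volume x‖ ≤ 1 := by
  rw [convolution_normed_apply, ← ρ.integral_normed (μ := volume)]
  refine norm_integral_le_of_norm_le ρ.integrable_normed (Eventually.of_forall fun t => ?_)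
  rw [norm_mul, Real.norm_of_nonneg (ρ.nonneg_normed t)]
  exact mul_le_of_le_one_right (ρ.nonneg_normed t) (hv _)

/-- If a uniformly bounded sequence with supports in a compact set converges weakly, then its
mollifications converge in `L¹`. -/
theorem exists_tendsto_convolution_normed (ρ : ContDiffBump (0 : EuclideanSpace ℝ (Fin N)))
    {v : ℕ → EuclideanSpace ℝ (Fin N) → ℝ} {K : Set (EuclideanSpace ℝ (Fin N))}
    (hK : IsCompact K) (hm : ∀ k, Integrable (v k)) (hb : ∀ k x, ‖v k x‖ ≤ 1)
    (hs : ∀ k, Function.support (v k) ⊆ K)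
    (hw : ∀ ψ : EuclideanSpace ℝ (Fin N) → ℝ, MemLp ψ 2 →
      ∃ L : ℝ, Tendsto (fun k => ∫ x, ψ x * v k x) atTop (𝓝 L)) :
    ∃ W : EuclideanSpace ℝ (Fin N) → ℝ, AEStronglyMeasurable W ∧
      Tendsto (fun k => ∫⁻ x, ‖convolution (ρ.normed volume) (v k) (lsmul ℝ ℝ) volume x - W x‖ₑ)
        atTop (𝓝 0) := by
  let w : ℕ → EuclideanSpace ℝ (Fin N) → ℝ := fun k =>
    convolution (ρ.normed volume) (v k) (lsmul ℝ ℝ) volume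
  have hwm : ∀ k, AEStronglyMeasurable (w k) := fun k =>
    (contDiff_convolution_normed ρ (hm k)).continuous.aestronglyMeasurable
  have hpt : ∀ x, ∃ L, Tendsto (fun k => w k x) atTop (𝓝 L) := fun x => by
    -- The mollification at x is an L² pairing with ρ(x − ·), so weak convergence gives pointwise
    -- convergence.
    have hψ : MemLp (fun t => ρ.normed volume (x - t)) 2 := by
      refine Continuous.memLp_of_hasCompactSupport (ρ.continuous_normed.comp (by fun_prop)) ?_
      exact ρ.hasCompactSupport_normed.comp_homeomorph (Homeomorph.subLeft x)
    obtain ⟨L, hL⟩ := hw _ hψ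
    refine ⟨L, hL.congr fun k => ?_⟩
    simp only [w]
    rw [convolution_normed_apply,
      ← integral_sub_left_eq_self (fun t => ρ.normed volume t * v k (x - t)) volume x]
    simp
  choose W hW using hpt
  refine ⟨W, aestronglyMeasurable_of_tendsto_ae atTop hwm (Eventually.of_forall hW), ?_⟩
  have hKc := hK.cthickening (r := ρ.rOut)
  have := tendsto_lintegral_norm_of_dominated_convergence (F := w) (f := W)
    (bound := (Metric.cthickening ρ.rOut K).indicator fun _ => 1) hwm
    ?_ (fun k => Eventually.of_forall fun x => ?_) (Eventually.of_forall hW)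
  · simpa only [ofReal_norm] using this
  · exact ((integrable_indicator_iff hKc.measurableSet).2
      (integrableOn_const hKc.measure_lt_top.ne)).hasFiniteIntegral
  · by_cases hx : x ∈ Metric.cthickening ρ.rOut K
    · rw [indicator_of_mem hx]
      exact norm_convolution_normed_le ρ (hb k) x
    · rw [indicator_of_notMem hx, norm_le_zero_iff]
      exact image_eq_zero_of_notMem_tsupport
        fun h => hx (tsupport_convolution_normed_subset ρ (hs k) h)

/-- Compactness in `L¹` of bounded sequences with bounded total variation and supports in a fixed
compact set. -/
theorem exists_subseq_tendsto_of_totalVariation_le {v : ℕ → EuclideanSpace ℝ (Fin N) → ℝ}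
    {K : Set (EuclideanSpace ℝ (Fin N))} (hK : IsCompact K) (hm : ∀ k, Integrable (v k))
    (hb : ∀ k x, ‖v k x‖ ≤ 1) (hs : ∀ k, Function.support (v k) ⊆ K) {C : ℝ≥0∞} (hC : C ≠ ∞)
    (hTV : ∀ k, totalVariation (v k) univ ≤ C) :
    ∃ (ns : ℕ → ℕ) (u : EuclideanSpace ℝ (Fin N) → ℝ), StrictMono ns ∧ Integrable u ∧
      Tendsto (fun k => ∫⁻ x, ‖v (ns k) x - u x‖ₑ) atTop (𝓝 0) := by
  have hgK : MemLp (K.indicator fun _ => (1 : ℝ)) 2 (volume : Measure (EuclideanSpace ℝ (Fin N))) :=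
    memLp_indicator_const 2 hK.measurableSet 1 (Or.inr hK.measure_lt_top.ne)
  obtain ⟨ns, hns, hweak⟩ := exists_subseq_tendsto_integral_mul
    (fun k => (hm k).aestronglyMeasurable) hgK (fun k x => by
      by_cases hx : x ∈ K
      · simpa [hx] using hb k x
      · have : v k x = 0 := Function.notMem_support.1 fun h => hx (hs k h)
        simp [this])
  let f : ℕ → Lp ℝ 1 (volume : Measure (EuclideanSpace ℝ (Fin N))) :=
    fun k => (memLp_one_iff_integrable.2 (hm (ns k))).toLp (v (ns k))
  have hdist : ∀ k l, edist (f k) (f l) = ∫⁻ x, ‖v (ns k) x - v (ns l) x‖ₑ := fun k l => by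
    simp only [f]
    rw [Lp.edist_toLp_toLp, eLpNorm_one_eq_lintegral_enorm]
    rfl
  have hcau : CauchySeq f := by
    rw [EMetric.cauchySeq_iff]
    intro ε hε
    -- Four distances: from v_k to its mollification, on to W, to the mollification of v_l, and to
    -- v_l.
    obtain ⟨δ, hδ, hδε⟩ : ∃ δ : ℝ≥0∞, 0 < δ ∧ δ + (δ + (δ + δ)) < ε := by
      obtain ⟨δ, hδ, h⟩ := ENNReal.exists_nnreal_pos_mul_lt (a := 4) (by norm_num) hε.ne'
      refine ⟨δ, by exact_mod_cast hδ, ?_⟩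
      convert h using 1
      ring
    -- With r C < δ the translation estimate puts every term within δ of its mollification,
    -- uniformly in k.
    obtain ⟨r, hr, hrδ⟩ : ∃ r : NNReal, 0 < r ∧ r * C < δ :=
      ENNReal.exists_nnreal_pos_mul_lt hC hδ.ne'
    obtain ⟨ρ, hρ⟩ := exists_bump_rOut_eq (N := N) (r := r) (by exact_mod_cast hr)
    have hclose : ∀ k, ∫⁻ x,
        ‖convolution (ρ.normed volume) (v (ns k)) (lsmul ℝ ℝ) volume x - v (ns k) x‖ₑ ≤ δ :=
      fun k => lintegral_convolution_sub_le ρ (hm _) fun t ht => by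
        refine (lintegral_translate_sub_le (hm _) hK (hs _) t).trans (le_trans ?_ hrδ.le)
        gcongr
        · rw [← ofReal_norm]
          refine ENNReal.ofReal_le_of_le_toReal ?_
          rw [ENNReal.coe_toReal, ← hρ]
          exact ht.le
        · exact hTV _
    obtain ⟨W, hWm, hW⟩ := exists_tendsto_convolution_normed ρ hK (fun k => hm (ns k))
      (fun k => hb (ns k)) (fun k => hs (ns k)) hweak
    obtain ⟨n₀, hn₀⟩ := eventually_atTop.1 (hW.eventually_le_const hδ)
    refine ⟨n₀, fun k hk l hl => ?_⟩
    rw [hdist]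
    have hwm : ∀ k, AEStronglyMeasurable
        (convolution (ρ.normed volume) (v (ns k)) (lsmul ℝ ℝ) volume) := fun k =>
      (contDiff_convolution_normed ρ (hm _)).continuous.aestronglyMeasurable
    refine lt_of_le_of_lt ?_ hδε
    refine (lintegral_enorm_sub_le _ (hm _).aestronglyMeasurable (hwm k)).trans
      (add_le_add ?_ ((lintegral_enorm_sub_le _ (hwm k) hWm).trans (add_le_add (hn₀ k hk)
        ((lintegral_enorm_sub_le _ hWm (hwm l)).trans (add_le_add ?_ (hclose l))))))
    · simp_rw [enorm_sub_rev (v (ns k) _)]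
      exact hclose k
    · simp_rw [enorm_sub_rev (W _)]
      exact hn₀ l hl
  obtain ⟨u, hu⟩ := cauchySeq_tendsto_of_complete hcau
  refine ⟨ns, u, hns, L1.integrable_coeFn u, ?_⟩
  have := tendsto_iff_edist_tendsto_0.1 hu
  refine this.congr fun k => ?_
  rw [Lp.edist_def, eLpNorm_one_eq_lintegral_enorm]
  refine lintegral_congr_ae ?_
  filter_upwards [(memLp_one_iff_integrable.2 (hm (ns k))).coeFn_toLp] with x hx
  simp only [f, Pi.sub_apply]
  rw [hx]

end Compactness

/-! ### Approximation from inside a domain with graph boundary. -/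

section InnerApproximation

open Filter

variable {N : ℕ}

/-- Near each point of its closure, a domain with graph boundary can be pushed into itself by small
translations in a fixed direction. -/
theorem HasGraphBoundary.exists_translate_mem {Ω : Set (EuclideanSpace ℝ (Fin N))}
    (hΩ : IsOpen Ω) (hb : HasGraphBoundary Ω) {x : EuclideanSpace ℝ (Fin N)}
    (hx : x ∈ closure Ω) :
    ∃ (e : EuclideanSpace ℝ (Fin N)) (U : Set (EuclideanSpace ℝ (Fin N))), IsOpen U ∧ x ∈ U ∧
      ∀ K ⊆ U, IsCompact K → ∀ᶠ t : ℝ in 𝓝[>] 0, ∀ y ∈ K ∩ closure Ω, y + t • e ∈ Ω := by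
  by_cases hxΩ : x ∈ Ω
  -- Near an interior point no push is needed.
  · exact ⟨0, Ω, hΩ, hxΩ, fun K hK _ => Eventually.of_forall fun t y hy => by simpa using hK hy.1⟩
  obtain ⟨e, γ, he, hγ, hγe, U, hU, hUΩ⟩ := hb x ⟨hx, by rwa [hΩ.interior_eq]⟩
  refine ⟨e, interior U, isOpen_interior, mem_interior_iff_mem_nhds.2 hU, fun K hKU hK => ?_⟩
  obtain ⟨δ, hδ, hδU⟩ := hK.exists_cthickening_subset_open isOpen_interior hKU
  filter_upwards [Ioo_mem_nhdsGT hδ] with t ht y hy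
  have hmem : y + t • e ∈ U := interior_subset (hδU (Metric.mem_cthickening_of_dist_le _ y _ _ hy.1
    (by simpa [norm_smul, he, abs_of_pos ht.1] using ht.2.le)))
  -- On the closure only the weak inequality survives; the shift by t > 0 along e leaves γ unchanged
  -- and makes it strict.
  have hle : γ y ≤ inner ℝ e y := by
    have h1 : y ∈ closure (interior U ∩ Ω) := isOpen_interior.inter_closure ⟨hKU hy.1, hy.2⟩
    have h2 : IsClosed {z : EuclideanSpace ℝ (Fin N) | γ z ≤ inner ℝ e z} :=
      isClosed_le hγ (by fun_prop)
    exact closure_minimal (fun z hz => ((hUΩ z (interior_subset hz.1)).1 hz.2).le) h2 h1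
  rw [hUΩ _ hmem, hγe, inner_add_right, inner_smul_right, real_inner_self_eq_norm_sq, he]
  linarith [ht.1]

theorem integrable_smul_of_eq_zero_off_compact {E F : Type*} [NormedAddCommGroup E]
    [MeasurableSpace E] [OpensMeasurableSpace E] [SecondCountableTopology E]
    [NormedAddCommGroup F] [NormedSpace ℝ F] {μ : Measure E} {v : E → ℝ} {c : E → F}
    (hv : Integrable v μ) (hc : Continuous c)
    {K : Set E} (hK : IsCompact K) (h0 : ∀ x ∉ K, v x = 0) :
    Integrable (fun x => v x • c x) μ := by
  obtain ⟨C, hC⟩ := hK.exists_bound_of_continuousOn hc.continuousOn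
  refine (hv.norm.mul_const C).mono' (hv.aestronglyMeasurable.smul hc.aestronglyMeasurable)
    (Eventually.of_forall fun x => ?_)
  rw [norm_smul]
  by_cases hx : x ∈ K
  · exact mul_le_mul_of_nonneg_left (hC x hx) (norm_nonneg _)
  · simp [h0 x hx]

/-- On the open set Ω the partition sums to the constant 1, so its gradients cancel; elsewhere v
vanishes. -/
theorem sum_fderiv_partition_smul_eq_zero {ι : Type*} [Fintype ι]
    {ζ : ι → EuclideanSpace ℝ (Fin N) → ℝ} {v : EuclideanSpace ℝ (Fin N) → ℝ}
    {Ω : Set (EuclideanSpace ℝ (Fin N))} (hΩ : IsOpen Ω) (hv : ∀ x ∉ Ω, v x = 0)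
    (hζ : ∀ i, ContDiff ℝ 1 (ζ i)) (h1 : ∀ x ∈ Ω, ∑ i, ζ i x = 1)
    (x : EuclideanSpace ℝ (Fin N)) : ∑ i, v x • fderiv ℝ (ζ i) x = 0 := by
  rw [← Finset.smul_sum]
  by_cases hx : x ∈ Ω
  · have h2 : fderiv ℝ (fun y => ∑ i, ζ i y) x = ∑ i, fderiv ℝ (ζ i) x :=
      fderiv_fun_sum fun i _ => (hζ i).differentiable one_ne_zero x
    have h3 : (fun y => ∑ i, ζ i y) =ᶠ[𝓝 x] fun _ => 1 := by
      filter_upwards [hΩ.mem_nhds hx] with y hy using h1 y hy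
    rw [← h2, h3.fderiv_eq]
    simp
  · rw [hv x hx, zero_smul]

/-- Moving the pieces `ζ i * v` of a function by translations changes the total variation at most
by the `L¹` moduli of continuity of `v ∇ζ i`. -/
theorem totalVariation_sum_translate_le {ι : Type*} [Fintype ι]
    {ζ : ι → EuclideanSpace ℝ (Fin N) → ℝ} {v : EuclideanSpace ℝ (Fin N) → ℝ}
    (hv : Integrable v) (hζ : ∀ i, ContDiff ℝ 1 (ζ i)) (h0 : ∀ i x, 0 ≤ ζ i x)
    (h1 : ∀ x, ∑ i, ζ i x ≤ 1) (hζv : ∀ i, Integrable fun x => ζ i x * v x)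
    (hG : ∀ i, Integrable fun x => v x • fderiv ℝ (ζ i) x)
    (hG0 : ∀ x, ∑ i, v x • fderiv ℝ (ζ i) x = 0) (e : ι → EuclideanSpace ℝ (Fin N)) :
    totalVariation (fun x => ∑ i, ζ i (x - e i) * v (x - e i)) univ ≤ totalVariation v univ +
      ∑ i, ∫⁻ x, ‖v (x - e i) • fderiv ℝ (ζ i) (x - e i) - v x • fderiv ℝ (ζ i) x‖ₑ := by
  refine totalVariation_le fun φ hφ => ?_
  let G : ι → EuclideanSpace ℝ (Fin N) → EuclideanSpace ℝ (Fin N) →L[ℝ] ℝ :=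
    fun i x => v x • fderiv ℝ (ζ i) x
  let ψ : ι → EuclideanSpace ℝ (Fin N) → EuclideanSpace ℝ (Fin N) := fun i x => φ (x + e i)
  have hψ : ∀ i, ψ i ∈ testFields univ := fun i => comp_add_right_mem_testFields hφ (e i)
  have hΦ := sum_smul_mem_testFields hζ h0 h1 hψ
  have happ : ∀ {H : EuclideanSpace ℝ (Fin N) → EuclideanSpace ℝ (Fin N) →L[ℝ] ℝ}
      {χ : EuclideanSpace ℝ (Fin N) → EuclideanSpace ℝ (Fin N)}, Integrable H →
      χ ∈ testFields univ → Integrable fun x => H x (χ x) := fun {H χ} hH hχ => by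
    refine hH.norm.mono' ?_ (Eventually.of_forall fun x => ?_)
    · exact isBoundedBilinearMap_apply.continuous.comp_aestronglyMeasurable
        (hH.aestronglyMeasurable.prodMk hχ.1.continuous.aestronglyMeasurable)
    · exact ((H x).le_opNorm _).trans (mul_le_of_le_one_right (norm_nonneg _) (hχ.2.2.2 x))
  have hGt : ∀ i, Integrable fun x => G i (x - e i) := fun i => (hG i).comp_sub_right (e i)
  have hζψ : ∀ i, ContDiff ℝ 1 fun y => ζ i y • ψ i y := fun i => (hζ i).smul (hψ i).1
  have hcs : ∀ i, HasCompactSupport fun y => ζ i y • ψ i y :=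
    fun i => hasCompactSupport_smul_field (ζ i) (hψ i).2.1
  have hint : ∀ i, Integrable fun x => v x * divergence (fun y => ζ i y • ψ i y) x :=
    fun i => integrable_mul_divergence (hζψ i) (hcs i) hv.locallyIntegrable
  -- After translating back, the product rule reads ζ div ψ = div(ζψ) − ∇ζ·ψ.
  have hpiece : ∀ i, ∫ x, ζ i (x - e i) * v (x - e i) * divergence φ x =
      (∫ x, v x * divergence (fun y => ζ i y • ψ i y) x) - ∫ x, G i (x - e i) (φ x) := fun i => by
    have hshift : ∫ x, G i (x - e i) (φ x) = ∫ x, G i x (ψ i x) := by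
      rw [← integral_add_right_eq_self (fun x => G i (x - e i) (φ x)) (e i)]
      simp [ψ]
    rw [hshift, ← integral_sub (hint i) (happ (hG i) (hψ i)),
      ← integral_add_right_eq_self (fun x => ζ i (x - e i) * v (x - e i) * divergence φ x) (e i)]
    refine integral_congr_ae (Eventually.of_forall fun x => ?_)
    simp only [add_sub_cancel_right]
    rw [divergence_smul ((hζ i).differentiable one_ne_zero x)
      ((hψ i).1.differentiable one_ne_zero x)]
    have hd : divergence (ψ i) x = divergence φ (x + e i) := divergence_comp_add_right φ (e i) x
    rw [hd, smul_apply, smul_eq_mul]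
    ring
  have hpint : ∀ i, Integrable fun x => ζ i (x - e i) * v (x - e i) * divergence φ x := fun i =>
    integrable_mul_divergence hφ.1 hφ.2.1 ((hζv i).comp_sub_right (e i)).locallyIntegrable
  -- The first term pairs v with the admissible field ∑ ζ i ψ i. Since ∑ G i = 0, the unshifted G i
  -- can be inserted for free, and only small differences remain.
  have htotal : ∫ x, (∑ i, ζ i (x - e i) * v (x - e i)) * divergence φ x =
      (∫ x, v x * divergence (fun y => ∑ i, ζ i y • ψ i y) x) +
        ∑ i, ∫ x, -((G i (x - e i) - G i x) (φ x)) := by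
    simp_rw [Finset.sum_mul]
    rw [integral_finsetSum _ fun i _ => hpint i]
    simp_rw [hpiece, integral_neg, sub_apply]
    rw [Finset.sum_sub_distrib]
    refine (sub_eq_add_neg _ _).trans ?_
    congr 1
    · rw [← integral_finsetSum _ fun i _ => hint i]
      refine integral_congr_ae (Eventually.of_forall fun x => ?_)
      simp only
      rw [← Finset.mul_sum, divergence_sum _ fun i _ => (hζψ i).differentiable one_ne_zero x]
    · have h2 : ∀ i, ∫ x, (G i (x - e i) (φ x) - G i x (φ x)) =
          (∫ x, G i (x - e i) (φ x)) - ∫ x, G i x (φ x) := fun i =>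
        integral_sub (happ (hGt i) hφ) (happ (hG i) hφ)
      have h3 : ∑ i, ∫ x, G i x (φ x) = 0 := by
        rw [← integral_finsetSum _ fun i _ => happ (hG i) hφ]
        have : ∀ x, ∑ i, G i x (φ x) = 0 := fun x => by
          rw [← sum_apply, hG0 x, zero_apply]
        exact (integral_congr_ae (Eventually.of_forall this)).trans (integral_zero _ _)
      simp_rw [h2]
      rw [Finset.sum_neg_distrib, Finset.sum_sub_distrib, h3, sub_zero]
  rw [htotal]
  refine ENNReal.ofReal_add_le.trans (add_le_add (ofReal_integral_le_totalVariation hΦ v) ?_)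
  refine (Finset.le_sum_of_subadditive _ ENNReal.ofReal_zero.le
    (fun _ _ => ENNReal.ofReal_add_le) _ _).trans (Finset.sum_le_sum fun i _ => ?_)
  refine (ofReal_integral_le_lintegral_enorm _).trans (lintegral_mono fun x => ?_)
  simp only [enorm_neg]
  rw [← ofReal_norm, ← ofReal_norm]
  exact ENNReal.ofReal_le_ofReal (((G i (x - e i) - G i x).le_opNorm _).trans
    (mul_le_of_le_one_right (norm_nonneg _) (hφ.2.2.2 x)))

/-- Functions that vanish outside a bounded domain with graph boundary are approximated in `L¹`
and in variation by functions supported in compact subsets of the domain. -/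
theorem HasGraphBoundary.exists_inner_approx {Ω : Set (EuclideanSpace ℝ (Fin N))}
    (hΩ : IsOpen Ω) (hbd : Bornology.IsBounded Ω) (hb : HasGraphBoundary Ω)
    {v : EuclideanSpace ℝ (Fin N) → ℝ} (hv : Integrable v) (hv0 : ∀ x ∉ Ω, v x = 0)
    {η : ℝ≥0∞} (hη : 0 < η) :
    ∃ (u : EuclideanSpace ℝ (Fin N) → ℝ) (K : Set (EuclideanSpace ℝ (Fin N))), Integrable u ∧
      IsCompact K ∧ K ⊆ Ω ∧ Function.support u ⊆ K ∧ ∫⁻ x, ‖u x - v x‖ₑ ≤ η ∧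
      totalVariation u univ ≤ totalVariation v univ + η := by
  have hcl : IsCompact (closure Ω) := hbd.isCompact_closure
  have hv0' : ∀ x ∉ closure Ω, v x = 0 := fun x hx => hv0 x fun h => hx (subset_closure h)
  choose e U hU hxU hK using fun x : closure Ω => hb.exists_translate_mem hΩ x.2
  obtain ⟨T, hT⟩ := hcl.elim_finite_subcover U hU fun x hx => mem_iUnion.2 ⟨⟨x, hx⟩, hxU _⟩
  obtain ⟨ζ, hζ, hζU, h0, h1, hζ1⟩ := exists_smooth_partition isClosed_closure
    (fun i : T => U i) (fun i => hU i) (by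
      intro x hx
      obtain ⟨i, hi, hxi⟩ := mem_iUnion₂.1 (hT hx)
      exact mem_iUnion.2 ⟨⟨i, hi⟩, hxi⟩)
  have hζd : ∀ i, ContDiff ℝ 1 (ζ i) := fun i => (hζ i).of_le (by norm_num)
  have hfc : ∀ i, Continuous fun x => fderiv ℝ (ζ i) x :=
    fun i => (hζd i).continuous_fderiv one_ne_zero
  have hζv : ∀ i, Integrable fun x => ζ i x * v x := fun i => by
    have := integrable_smul_of_eq_zero_off_compact hv (hζd i).continuous hcl hv0'
    simpa [mul_comm] using this
  have hG : ∀ i, Integrable fun x => v x • fderiv ℝ (ζ i) x := fun i =>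
    integrable_smul_of_eq_zero_off_compact hv (hfc i) hcl hv0'
  have hG0 := sum_fderiv_partition_smul_eq_zero hΩ hv0 hζd fun x hx => hζ1 x (subset_closure hx)
  let K : T → Set (EuclideanSpace ℝ (Fin N)) := fun i => tsupport (ζ i) ∩ closure Ω
  have hKc : ∀ i, IsCompact (K i) := fun i => hcl.inter_left (isClosed_tsupport _)
  -- All pieces share one parameter t > 0, so finitely many smallness conditions hold at once.
  have hneg : ∀ i : T, Tendsto (fun t : ℝ => -(t • e i)) (𝓝[>] 0) (𝓝 0) := fun i => by
    have : Continuous fun t : ℝ => -(t • e i) := by fun_prop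
    have h := this.tendsto 0
    simp only [zero_smul, neg_zero] at h
    exact h.mono_left nhdsWithin_le_nhds
  have ev1 : ∀ᶠ t : ℝ in 𝓝[>] 0, ∀ i : T, ∀ y ∈ K i, y + t • e i ∈ Ω :=
    eventually_all.2 fun i => (hK i (K i) (inter_subset_left.trans (hζU i)) (hKc i)).mono
      fun t ht y hy => ht y ⟨hy, hy.2⟩
  have ev2 : ∀ᶠ t : ℝ in 𝓝[>] 0, ∑ i : T, ∫⁻ x, ‖ζ i (x - t • e i) * v (x - t • e i) -
      ζ i x * v x‖ₑ ≤ η := by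
    refine Tendsto.eventually_le_const (v := ∑ _ : T, 0) (by simpa using hη) ?_
    refine tendsto_finsetSum _ fun i _ => ?_
    simpa only [sub_eq_add_neg, Function.comp_def] using
      (tendsto_lintegral_enorm_sub_translate (hζv i)).comp (hneg i)
  have ev3 : ∀ᶠ t : ℝ in 𝓝[>] 0, ∑ i : T, ∫⁻ x, ‖v (x - t • e i) • fderiv ℝ (ζ i) (x - t • e i) -
      v x • fderiv ℝ (ζ i) x‖ₑ ≤ η := by
    refine Tendsto.eventually_le_const (v := ∑ _ : T, 0) (by simpa using hη) ?_
    refine tendsto_finsetSum _ fun i _ => ?_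
    have := (tendsto_lintegral_enorm_sub_translate (hG i)).comp (hneg i)
    simpa only [sub_eq_add_neg, Function.comp_def] using this
  obtain ⟨t, ht1, ht2, ht3⟩ := (ev1.and (ev2.and ev3)).exists
  refine ⟨fun x => ∑ i : T, ζ i (x - t • e i) * v (x - t • e i),
    ⋃ i : T, (fun y => y + t • e i) '' K i,
    integrable_finsetSum _ fun i _ => (hζv i).comp_sub_right (t • e i),
    isCompact_iUnion fun i => (hKc i).image (continuous_id.add continuous_const),
    iUnion_subset fun i => ?_, fun x hx => ?_, ?_,
    (totalVariation_sum_translate_le hv hζd h0 h1 hζv hG hG0 fun i : T => t • e i).trans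
      (add_le_add le_rfl ht3)⟩
  · rintro _ ⟨y, hy, rfl⟩
    exact ht1 i y hy
  · obtain ⟨i, -, hi⟩ := Finset.exists_ne_zero_of_sum_ne_zero hx
    refine mem_iUnion.2 ⟨i, x - t • e i, ⟨subset_tsupport _ (left_ne_zero_of_mul hi), ?_⟩, by simp⟩
    by_contra h
    exact right_ne_zero_of_mul hi (hv0' _ h)
  · have hvsum : ∀ x, v x = ∑ i : T, ζ i x * v x := fun x => by
      rw [← Finset.sum_mul]
      by_cases hx : x ∈ closure Ω
      · rw [hζ1 x hx, one_mul]
      · rw [hv0' x hx, mul_zero]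
    refine le_trans ?_ ht2
    rw [← lintegral_finsetSum' (f := fun (i : T) x =>
      ‖ζ i (x - t • e i) * v (x - t • e i) - ζ i x * v x‖ₑ) _ fun i _ =>
      (((hζv i).comp_sub_right (t • e i)).sub (hζv i)).aestronglyMeasurable.enorm]
    refine lintegral_mono fun x => ?_
    simp only
    conv_lhs => rw [hvsum x, ← Finset.sum_sub_distrib]
    exact enorm_sum_le _ _

/-- Where the two characteristic functions differ, w is at distance at least δ from χ_F, because s
keeps δ away from both 0 and 1. -/
theorem lintegral_superlevel_sub_charFn_le {w : EuclideanSpace ℝ (Fin N) → ℝ}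
    (F : Set (EuclideanSpace ℝ (Fin N))) {δ s : ℝ} (hδ : 0 < δ) (hs : s ∈ Ioo δ (1 - δ)) :
    ENNReal.ofReal δ * ∫⁻ x, ‖charFn {x | s < w x} x - charFn F x‖ₑ ≤
      ∫⁻ x, ‖w x - charFn F x‖ₑ := by
  rw [← lintegral_const_mul' _ _ ENNReal.ofReal_ne_top]
  refine lintegral_mono fun x => ?_
  simp only [← ofReal_norm, Real.norm_eq_abs]
  rw [← ENNReal.ofReal_mul hδ.le]
  refine ENNReal.ofReal_le_ofReal ?_
  have h1 := hs.1
  have h2 := hs.2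
  by_cases hx : s < w x <;> by_cases hF : x ∈ F <;> simp [charFn, hx, hF]
  · exact (by linarith : δ ≤ w x).trans (le_abs_self _)
  · rw [abs_sub_comm]
    exact (by linarith [not_lt.1 hx] : δ ≤ 1 - w x).trans (le_abs_self _)

/-- Caccioppoli sets in a bounded domain with graph boundary are approximated in measure and in
perimeter by sets with compact closure in the domain. -/
theorem HasGraphBoundary.exists_inner_set_approx {Ω : Set (EuclideanSpace ℝ (Fin N))}
    (hΩ : IsOpen Ω) (hbd : Bornology.IsBounded Ω) (hb : HasGraphBoundary Ω)
    {F : Set (EuclideanSpace ℝ (Fin N))} (hF : Integrable (charFn F)) (hFΩ : F ⊆ Ω)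
    (hTV : totalVariation (charFn F) univ ≠ ∞) {ε : ℝ} (hε : 0 < ε) :
    ∃ E : Set (EuclideanSpace ℝ (Fin N)), MeasurableSet E ∧ IsCompact (closure E) ∧
      closure E ⊆ Ω ∧
      totalVariation (charFn E) univ ≤ totalVariation (charFn F) univ + ENNReal.ofReal ε ∧
      ∫⁻ x, ‖charFn E x - charFn F x‖ₑ ≤ ENNReal.ofReal ε := by
  set τ := (totalVariation (charFn F) univ).toReal with hτ
  have hτ0 : 0 ≤ τ := ENNReal.toReal_nonneg
  have hTVτ : totalVariation (charFn F) univ = ENNReal.ofReal τ := (ENNReal.ofReal_toReal hTV).symm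
  -- Levels are sought in (δ, 1 − δ), of length 1 − 2δ. With η ≤ δ, the last condition is what gives
  -- (τ + η)/(1 − 2δ) ≤ τ + ε.
  obtain ⟨δ, hδ, hδ4, hδε⟩ : ∃ δ : ℝ, 0 < δ ∧ δ ≤ 1 / 4 ∧ δ * (1 + 2 * (τ + ε)) ≤ ε := by
    refine ⟨min (1 / 4) (ε / (1 + 2 * (τ + ε))), by positivity, min_le_left _ _, ?_⟩
    exact (mul_le_mul_of_nonneg_right (min_le_right _ _) (by positivity)).trans
      (div_mul_cancel₀ _ (by positivity)).le
  -- The inner approximation and the mollification each cost η in L¹, and thresholding divides the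
  -- total by δ.
  obtain ⟨η, hη, hηδ, hηε⟩ : ∃ η : ℝ, 0 < η ∧ η ≤ δ ∧ η + η ≤ δ * ε :=
    ⟨min δ (δ * ε / 2), by positivity, min_le_left _ _, by
      linarith [min_le_right δ (δ * ε / 2)]⟩
  have hη' : 0 < ENNReal.ofReal η := ENNReal.ofReal_pos.2 hη
  obtain ⟨u, K, hu, hK, hKΩ, huK, huF, huTV⟩ := hb.exists_inner_approx hΩ hbd hF
    (fun x hx => indicator_of_notMem (fun h => hx (hFΩ h)) _) hη'
  obtain ⟨r, hr, hrΩ⟩ := hK.exists_cthickening_subset_open hΩ hKΩ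
  obtain ⟨w, hw, hwc, hws, hwu, hwTV⟩ := exists_smooth_approx hu hK huK hr hη'
  have hw1 : ContDiff ℝ 1 w := hw.of_le (by norm_num)
  have hwF : ∫⁻ x, ‖w x - charFn F x‖ₑ ≤ ENNReal.ofReal (δ * ε) := by
    refine (lintegral_enorm_sub_le _ hw.continuous.aestronglyMeasurable
      hu.aestronglyMeasurable).trans ((add_le_add hwu huF).trans ?_)
    rw [← ENNReal.ofReal_add hη.le hη.le]
    exact ENNReal.ofReal_le_ofReal hηε
  obtain ⟨s, hs, hsTV⟩ := exists_totalVariation_superlevel_le hw1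
    (show δ < 1 - δ by linarith)
  have hsub : closure {x | s < w x} ⊆ tsupport w :=
    closure_mono fun x hx => (show w x ≠ 0 from ((hδ.trans hs.1).trans hx).ne')
  refine ⟨{x | s < w x}, (isOpen_lt continuous_const hw.continuous).measurableSet,
    hwc.isCompact.of_isClosed_subset isClosed_closure hsub, hsub.trans (hws.trans hrΩ),
    hsTV.trans ?_, ?_⟩
  · have h1 : ∫⁻ x, ‖fderiv ℝ w x‖ₑ ≤ ENNReal.ofReal (τ + η) := by
      rw [ENNReal.ofReal_add hτ0 hη.le, ← hTVτ]
      exact (lintegral_fderiv_le_totalVariation hw hwc).trans (hwTV.trans huTV)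
    rw [hTVτ, ← ENNReal.ofReal_add hτ0 hε.le]
    refine (ENNReal.div_le_div_right h1 _).trans ?_
    rw [← ENNReal.ofReal_div_of_pos (by linarith)]
    refine ENNReal.ofReal_le_ofReal ((div_le_iff₀ (by linarith)).2 ?_)
    nlinarith
  · have h2 := (lintegral_superlevel_sub_charFn_le (w := w) F hδ hs).trans hwF
    rw [ENNReal.ofReal_mul hδ.le] at h2
    exact (ENNReal.mul_le_mul_iff_right (ENNReal.ofReal_pos.2 hδ).ne' ENNReal.ofReal_ne_top).1 h2

end InnerApproximation

/-! ### The two inequalities between λ_{0,n} and the relaxed energy. -/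

section Existence

open Filter

variable {N : ℕ}

theorem charFn_inter (E Ω : Set (EuclideanSpace ℝ (Fin N))) :
    charFn (E ∩ Ω) = Ω.indicator (charFn E) := by
  rw [charFn, inter_comm, ← indicator_indicator, charFn]

theorem integrable_charFn_inter {F Ω : Set (EuclideanSpace ℝ (Fin N))} (hΩ : IsOpen Ω)
    (hF : IntegrableOn (charFn F) Ω) : Integrable (charFn (F ∩ Ω)) := by
  rw [charFn_inter]
  exact (integrable_indicator_iff hΩ.measurableSet).2 hF

theorem penalty_eq_ofReal_integral (n : ℕ) {Ω E : Set (EuclideanSpace ℝ (Fin N))}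
    (hΩ : IsOpen Ω) :
    penalty n Ω E = ENNReal.ofReal (n * ((∫ x, charFn (E ∩ Ω) x) - 1) ^ 2) := by
  rw [penalty, charFn_inter, integral_indicator hΩ.measurableSet]

/-- The relaxed energy of a set is the perimeter in the whole space of its part in `Ω`, plus the
penalization. -/
theorem relaxedEnergy_eq (n : ℕ) {F Ω : Set (EuclideanSpace ℝ (Fin N))} (hΩ : IsOpen Ω)
    (hF : IntegrableOn (charFn F) Ω) :
    relaxedEnergy n Ω F = totalVariation (charFn (F ∩ Ω)) univ + penalty n Ω F := by
  rw [relaxedEnergy, boundaryTerm, totalVariation_univ_eq_add_variationOn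
    (integrable_charFn_inter hΩ hF).locallyIntegrable hΩ
    fun x hx => indicator_of_notMem (fun h => hx h.2) _, charFn_inter]
  congr 2
  exact totalVariation_congr (Eventually.of_forall fun x hx => by rw [indicator_of_mem hx])

/-- A set with closure in `Ω` has the same total variation in `Ω` and in the whole
space. -/
theorem totalVariation_univ_eq_of_closure_subset {E Ω : Set (EuclideanSpace ℝ (Fin N))}
    (hΩ : IsOpen Ω) (hE : Integrable (charFn E)) (hEΩ : closure E ⊆ Ω) :
    totalVariation (charFn E) univ = totalVariation (charFn E) Ω := by
  refine le_antisymm ?_ (totalVariation_mono (subset_univ _) _)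
  rw [totalVariation_univ_eq_add_variationOn hE.locallyIntegrable hΩ
    fun x hx => indicator_of_notMem (fun h => hx (hEΩ (subset_closure h))) _]
  have h0 : variationOn (charFn E) (frontier Ω) ≤ 0 := by
    refine (iInf_le (fun U : {U : Set (EuclideanSpace ℝ (Fin N)) //
      IsOpen U ∧ frontier Ω ⊆ U} => totalVariation (charFn E) U.1)
      ⟨(closure E)ᶜ, isClosed_closure.isOpen_compl, fun x hx hx' => ?_⟩).trans ?_
    · exact hx.2 (by rw [hΩ.interior_eq]; exact hEΩ hx')
    · refine totalVariation_le fun φ hφ => ?_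
      have : ∀ x, charFn E x * divergence φ x = 0 := fun x => by
        by_cases hx : x ∈ E
        · rw [divergence_eq_zero_of_notMem_tsupport fun h => hφ.2.2.1 h (subset_closure hx),
            mul_zero]
        · rw [charFn, indicator_of_notMem hx, zero_mul]
      simp [this]
  rw [le_zero_iff.1 h0, add_zero]

/-- The empty set is a competitor of finite energy. Finiteness bounds the variation along a
minimizing sequence. -/
theorem lambdaZero_lt_top (n : ℕ) (Ω : Set (EuclideanSpace ℝ (Fin N))) : lambdaZero n Ω < ∞ := by
  have hch : charFn (∅ : Set (EuclideanSpace ℝ (Fin N))) = fun _ => 0 := by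
    ext x; simp [charFn]
  have hTV : totalVariation (charFn (∅ : Set (EuclideanSpace ℝ (Fin N)))) Ω = 0 := by
    refine le_antisymm (totalVariation_le fun φ _ => ?_) zero_le
    simp [hch]
  have hcac : IsCaccioppoli (∅ : Set (EuclideanSpace ℝ (Fin N))) Ω :=
    ⟨by rw [hch]; exact integrableOn_zero, by rw [hTV]; exact ENNReal.zero_lt_top⟩
  refine (iInf_le (fun E : {E : Set (EuclideanSpace ℝ (Fin N)) //
    IsCaccioppoli E Ω ∧ IsCompact (closure E) ∧ closure E ⊆ Ω} => energy n Ω E.1)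
    ⟨∅, hcac, by simp, by simp⟩).trans_lt ?_
  simp only [energy, hTV, zero_add, penalty]
  exact ENNReal.ofReal_lt_top

theorem norm_charFn_le (E : Set (EuclideanSpace ℝ (Fin N))) (x : EuclideanSpace ℝ (Fin N)) :
    ‖charFn E x‖ ≤ 1 := by
  by_cases hx : x ∈ E <;> simp [charFn, hx]

theorem integrable_charFn_of_measurableSet {E Ω : Set (EuclideanSpace ℝ (Fin N))}
    (hE : MeasurableSet E) (hEΩ : E ⊆ Ω) (hbd : Bornology.IsBounded Ω) : Integrable (charFn E) :=
  (integrable_indicator_iff hE).2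
    (integrableOn_const ((hbd.subset hEΩ).measure_lt_top.ne))

theorem tendsto_penalty {n : ℕ} {a : ℕ → ℝ} {b : ℝ} (h : Tendsto a atTop (𝓝 b)) :
    Tendsto (fun k => ENNReal.ofReal (n * (a k - 1) ^ 2)) atTop
      (𝓝 (ENNReal.ofReal (n * (b - 1) ^ 2))) :=
  (ENNReal.continuous_ofReal.tendsto _).comp (((h.sub_const 1).pow 2).const_mul _)

theorem tendsto_integral_charFn {E : ℕ → Set (EuclideanSpace ℝ (Fin N))}
    {F : Set (EuclideanSpace ℝ (Fin N))} (hF : Integrable (charFn F))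
    (hE : ∀ k, Integrable (charFn (E k)))
    (h : Tendsto (fun k => ∫⁻ x, ‖charFn (E k) x - charFn F x‖ₑ) atTop (𝓝 0)) :
    Tendsto (fun k => ∫ x, charFn (E k) x) atTop (𝓝 (∫ x, charFn F x)) :=
  tendsto_integral_of_L1 _ hF.aestronglyMeasurable (Eventually.of_forall hE) h

/-- The relaxed energy is bounded below by the infimum over sets compactly contained in the
domain. -/
theorem HasGraphBoundary.lambdaZero_le_relaxedEnergy (n : ℕ)
    {Ω : Set (EuclideanSpace ℝ (Fin N))} (hΩ : IsOpen Ω) (hbd : Bornology.IsBounded Ω)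
    (hb : HasGraphBoundary Ω) {F : Set (EuclideanSpace ℝ (Fin N))}
    (hF : IntegrableOn (charFn F) Ω) : lambdaZero n Ω ≤ relaxedEnergy n Ω F := by
  rw [relaxedEnergy_eq n hΩ hF, penalty_eq_ofReal_integral n hΩ]
  by_cases htop : totalVariation (charFn (F ∩ Ω)) univ = ∞
  · rw [htop, top_add]
    exact le_top
  have hFi := integrable_charFn_inter hΩ hF
  choose E hEm hEc hEΩ hETV hEF using fun k : ℕ => hb.exists_inner_set_approx hΩ hbd hFi
    inter_subset_right htop (Nat.one_div_pos_of_nat (α := ℝ) (n := k))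
  have hEsub : ∀ k, E k ⊆ Ω := fun k => subset_closure.trans (hEΩ k)
  have hEi : ∀ k, Integrable (charFn (E k)) := fun k =>
    integrable_charFn_of_measurableSet (hEm k) (hEsub k) hbd
  have hε : Tendsto (fun k : ℕ => ENNReal.ofReal (1 / ((k : ℝ) + 1))) atTop (𝓝 0) := by
    simpa [Function.comp_def] using (ENNReal.continuous_ofReal.tendsto _).comp
      (tendsto_one_div_add_atTop_nhds_zero_nat (𝕜 := ℝ))
  have hL1 : Tendsto (fun k => ∫⁻ x, ‖charFn (E k) x - charFn (F ∩ Ω) x‖ₑ) atTop (𝓝 0) :=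
    tendsto_of_tendsto_of_tendsto_of_le_of_le tendsto_const_nhds hε (fun _ => zero_le) hEF
  have hle : ∀ k : ℕ, lambdaZero n Ω ≤
      (totalVariation (charFn (F ∩ Ω)) univ + ENNReal.ofReal (1 / ((k : ℝ) + 1))) +
        ENNReal.ofReal (n * ((∫ x, charFn (E k) x) - 1) ^ 2) := fun k => by
    have hTVk : totalVariation (charFn (E k)) Ω ≤
        totalVariation (charFn (F ∩ Ω)) univ + ENNReal.ofReal (1 / ((k : ℝ) + 1)) :=
      (totalVariation_mono (subset_univ _) _).trans (hETV k)
    refine (iInf_le (fun E : {E : Set (EuclideanSpace ℝ (Fin N)) //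
      IsCaccioppoli E Ω ∧ IsCompact (closure E) ∧ closure E ⊆ Ω} => energy n Ω E.1)
      ⟨E k, ⟨(hEi k).integrableOn, hTVk.trans_lt (ENNReal.add_lt_top.2
        ⟨lt_top_iff_ne_top.2 htop, ENNReal.ofReal_lt_top⟩)⟩, hEc k, hEΩ k⟩).trans ?_
    refine add_le_add hTVk (le_of_eq ?_)
    rw [penalty_eq_ofReal_integral n hΩ, inter_eq_left.2 (hEsub k)]
  have hlim := (tendsto_const_nhds (x := totalVariation (charFn (F ∩ Ω)) univ)).add hε |>.add
    (tendsto_penalty (n := n) (tendsto_integral_charFn hFi hEi hL1))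
  rw [add_zero] at hlim
  exact ge_of_tendsto' hlim hle

/-- An `L¹` limit of characteristic functions of subsets of `Ω` is one. -/
theorem exists_charFn_of_tendsto {Ω : Set (EuclideanSpace ℝ (Fin N))}
    {E : ℕ → Set (EuclideanSpace ℝ (Fin N))} (hE : ∀ k, Integrable (charFn (E k)))
    (hEΩ : ∀ k, E k ⊆ Ω) {u : EuclideanSpace ℝ (Fin N) → ℝ} (hu : Integrable u)
    (h : Tendsto (fun k => ∫⁻ x, ‖charFn (E k) x - u x‖ₑ) atTop (𝓝 0)) :
    ∃ F ⊆ Ω, charFn F =ᵐ[volume] u := by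
  have hL1 : Tendsto (fun k => eLpNorm (charFn (E k) - u) 1 volume) atTop (𝓝 0) := by
    simpa only [eLpNorm_one_eq_lintegral_enorm, Pi.sub_apply] using h
  obtain ⟨ns, -, hns⟩ := (tendstoInMeasure_of_tendsto_eLpNorm one_ne_zero
    (fun k => (hE k).aestronglyMeasurable) hu.aestronglyMeasurable hL1).exists_seq_tendsto_ae
  refine ⟨{x | x ∈ Ω ∧ u x = 1}, fun x hx => hx.1, ?_⟩
  filter_upwards [hns] with x hx
  -- Along an a.e. convergent subsequence the values stay in the closed set {0, 1}.
  have hmem : u x ∈ ({0, 1} : Set ℝ) := by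
    refine (Set.toFinite _).isClosed.mem_of_tendsto hx (Eventually.of_forall fun k => ?_)
    by_cases hxk : x ∈ E (ns k) <;> simp [charFn, hxk]
  by_cases hxΩ : x ∈ Ω
  · rcases hmem with h0 | h1
    · simp [charFn, h0]
    · rw [mem_singleton_iff] at h1
      simp [charFn, h1, hxΩ]
  · have : u x = 0 := tendsto_nhds_unique hx (tendsto_const_nhds.congr fun k => by
      rw [charFn, indicator_of_notMem fun h => hxΩ (hEΩ _ h)])
    simp [charFn, this]

/-- The direct method. The limit set may touch ∂Ω; measuring perimeter in all of ℝ^N keeps lower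
semicontinuity valid there. -/
theorem exists_relaxedEnergy_le_lambdaZero (n : ℕ) {Ω : Set (EuclideanSpace ℝ (Fin N))}
    (hΩ : IsOpen Ω) (hbd : Bornology.IsBounded Ω) :
    ∃ E ⊆ Ω, IsCaccioppoli E univ ∧ relaxedEnergy n Ω E ≤ lambdaZero n Ω := by
  have htop := lambdaZero_lt_top n Ω
  have hne : Nonempty {E : Set (EuclideanSpace ℝ (Fin N)) //
      IsCaccioppoli E Ω ∧ IsCompact (closure E) ∧ closure E ⊆ Ω} := by
    by_contra h
    rw [not_nonempty_iff] at h
    rw [lambdaZero, iInf_of_empty] at htop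
    exact lt_irrefl _ htop
  obtain ⟨a, -, ha, haE⟩ := exists_seq_tendsto_sInf (S := range fun E :
    {E : Set (EuclideanSpace ℝ (Fin N)) // IsCaccioppoli E Ω ∧ IsCompact (closure E) ∧
      closure E ⊆ Ω} => energy n Ω E.1) (range_nonempty _) (OrderBot.bddBelow _)
  choose E hEa using haE
  have ha' : Tendsto a atTop (𝓝 (lambdaZero n Ω)) := ha
  -- Dropping the first k₀ terms makes every energy at most λ + 1, a uniform bound for the
  -- compactness theorem.
  obtain ⟨k₀, hk₀⟩ := eventually_atTop.1
    (ha'.eventually_le_const (ENNReal.lt_add_right htop.ne one_ne_zero))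
  let D : ℕ → Set (EuclideanSpace ℝ (Fin N)) := fun k => (E (k + k₀)).1
  have hDΩ : ∀ k, D k ⊆ Ω := fun k => subset_closure.trans (E (k + k₀)).2.2.2
  have hDi : ∀ k, Integrable (charFn (D k)) := fun k => by
    have := integrable_charFn_inter hΩ (E (k + k₀)).2.1.1
    rwa [inter_eq_left.2 (hDΩ k)] at this
  have hDe : ∀ k, totalVariation (charFn (D k)) univ +
      ENNReal.ofReal (n * ((∫ x, charFn (D k) x) - 1) ^ 2) = a (k + k₀) := fun k => by
    rw [← hEa (k + k₀)]
    change _ = totalVariation (charFn (D k)) Ω + penalty n Ω (D k)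
    rw [penalty_eq_ofReal_integral n hΩ,
      totalVariation_univ_eq_of_closure_subset hΩ (hDi k) (E (k + k₀)).2.2.2,
      inter_eq_left.2 (hDΩ k)]
  obtain ⟨ns, u, hns, hu, hlim⟩ := exists_subseq_tendsto_of_totalVariation_le
    hbd.isCompact_closure hDi (fun k => norm_charFn_le (D k))
    (fun k => support_indicator_subset.trans ((hDΩ k).trans subset_closure))
    (C := lambdaZero n Ω + 1) (ENNReal.add_lt_top.2 ⟨htop, ENNReal.one_lt_top⟩).ne
    (fun k => (le_self_add.trans (hDe k).le).trans (hk₀ _ (Nat.le_add_left _ _)))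
  obtain ⟨F, hFΩ, hFu⟩ := exists_charFn_of_tendsto (fun k => hDi (ns k)) (fun k => hDΩ (ns k))
    hu hlim
  have hFi : Integrable (charFn F) := hu.congr hFu.symm
  have hlimF : Tendsto (fun k => ∫⁻ x, ‖charFn (D (ns k)) x - charFn F x‖ₑ) atTop (𝓝 0) := by
    refine hlim.congr fun k => lintegral_congr_ae ?_
    filter_upwards [hFu] with x hx
    rw [hx]
  have hpen := tendsto_penalty (n := n)
    (tendsto_integral_charFn hFi (fun k => hDi (ns k)) hlimF)
  have hle : relaxedEnergy n Ω F ≤ lambdaZero n Ω := by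
    rw [relaxedEnergy_eq n hΩ hFi.integrableOn, penalty_eq_ofReal_integral n hΩ,
      inter_eq_left.2 hFΩ]
    have hlsc := totalVariation_le_liminf_of_tendsto (U := univ) hFi (fun k => hDi (ns k)) hlimF
    have hak : Tendsto (fun k => a (ns k + k₀)) atTop (𝓝 (lambdaZero n Ω)) :=
      ha'.comp ((tendsto_add_atTop_nat k₀).comp hns.tendsto_atTop)
    -- Energies and penalizations converge, hence so do the perimeters. Subtraction in `ℝ≥0∞` is
    -- truncated, so adding the penalization back needs it to be at most λ.
    have hsub : Tendsto (fun k => totalVariation (charFn (D (ns k))) univ) atTop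
        (𝓝 (lambdaZero n Ω - ENNReal.ofReal (n * ((∫ x, charFn F x) - 1) ^ 2))) := by
      refine (ENNReal.Tendsto.sub hak hpen (Or.inl htop.ne)).congr fun k => ?_
      rw [← hDe, ENNReal.add_sub_cancel_right ENNReal.ofReal_ne_top]
    rw [hsub.liminf_eq] at hlsc
    refine (add_le_add hlsc le_rfl).trans_eq (tsub_add_cancel_of_le ?_)
    exact le_of_tendsto_of_tendsto' hpen hak fun k => le_add_self.trans (hDe (ns k)).le
  refine ⟨F, hFΩ, ⟨hFi.integrableOn, ?_⟩, hle⟩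
  have h1 := hle.trans_lt htop
  rw [relaxedEnergy_eq n hΩ hFi.integrableOn, inter_eq_left.2 hFΩ] at h1
  exact le_self_add.trans_lt h1

end Existence

theorem proposition5p3 (N : ℕ) (hN : 1 < N) (Ω : Set (EuclideanSpace ℝ (Fin N)))
    (hopen : IsOpen Ω) (hconn : IsConnected Ω) (hbdd : Bornology.IsBounded Ω)
    (hbdry : HasGraphBoundary Ω) (n : ℕ) (hn : 1 ≤ n) :
    ∃ E : Set (EuclideanSpace ℝ (Fin N)), E ⊆ Ω ∧ IsCaccioppoli E univ ∧
      relaxedEnergy n Ω E = lambdaZero n Ω ∧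
      ∀ F : Set (EuclideanSpace ℝ (Fin N)), IsCaccioppoli F Ω →
        relaxedEnergy n Ω E ≤ relaxedEnergy n Ω F := by
  obtain ⟨E, hEΩ, hE, hle⟩ := exists_relaxedEnergy_le_lambdaZero n hopen hbdd
  exact ⟨E, hEΩ, hE, le_antisymm hle (hbdry.lambdaZero_le_relaxedEnergy n hopen hbdd
    (hE.1.mono_set (subset_univ _))), fun F hF =>
      hle.trans (hbdry.lambdaZero_le_relaxedEnergy n hopen hbdd hF.1)⟩
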